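/- Let $d\in\mathbb N_0$, $T>0$, $p\in(2,3)$, and let $\mathbf X=(X,\mathbb X^{(2)})$ be a continuous $p$-rough path over $\mathbb R^d$ on $[0,T]$: $X:[0,T]\to\mathbb R^d$ is continuous of finite $p$-variation, $\mathbb X^{(2)}:\{0\le s\le t\le T\}\to\mathbb R^{d\times d}$ is continuous of finite $p/2$-variation, and $(\mathbb X^{(2)}_{s,t})^{ij}=(\mathbb X^{(2)}_{s,u})^{ij}+(\mathbb X^{(2)}_{u,t})^{ij}+X^i_{s,u}X^j_{u,t}$ for $s\le u\le t$, where $X_{s,t}:=X_t-X_s$; $\mathbf X$ need not be geometric. Let $$[\mathbf X]_t:=X_{0,t}\otimes X_{0,t}-\big(\mathbb X^{(2)}_{0,t}+(\mathbb X^{(2)}_{0,t})^\top\big)$$ be its bracket, and let $\widehat X_t:=\big(t,X_t,([\mathbf X]^{ij}_t)_{1\le i\le j\le d}\big)\in\mathbb R^{\hat d}$, $\hat d=1+d+\frac{d(d+1)}2$, be the path extended by time and the bracket terms. Index its components by $0,\dots,\hat d-1$, with $0$ for time and $1,\dots,d$ for $X$, let $e_0,\dots,e_{\hat d-1}$ be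 the canonical basis of $\mathbb R^{\hat d}$, let $\epsilon_{ij}=\epsilon_{ji}$ be the basis vector of the component $[\mathbf X]^{ij}$ for $1\le i\le j\le d$, and put $\epsilon_{ij}:=0$ unless both $i,j\in\{1,\dots,d\}$. For a word $I=(i_1,\dots,i_n)$ in $\{0,\dots,\hat d-1\}$ write $e_I=e_{i_1}\otimes\dots\otimes e_{i_n}$, and $I'=(i_1,\dots,i_{n-1})$ if $n\ge1$. Let $\widehat{\mathbb X}^{(2)}$ be the canonical second level over $\widehat X$: for $0\le s\le t\le T$, $(\widehat{\mathbb X}^{(2)}_{s,t})^{ij}=(\mathbb X^{(2)}_{s,t})^{ij}$ if $i,j\in\{1,\dots,d\}$, and otherwise $(\widehat{\mathbb X}^{(2)}_{s,t})^{ij}=\int_s^t\widehat X^i_{s,r}\,\mathrm d\widehat X^j_r$ as a Young integral (limit of left-point Riemann sums as the mesh tends to $0$). Let $\widehat{\mathbb X}$ be Lyons' extension of $(1,\widehat X,\widehat{\mathbb X}^{(2)})$, that is, the continuous map $(s,t)\mapsto\widehat{\mathbb X}_{s,t}\in T((\mathbb R^{\hat d}))$, $0\le s\le t\le T$, with levels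 $0,1,2$ equal to $1,\widehat X_{s,t},\widehat{\mathbb X}^{(2)}_{s,t}$, with $\widehat{\mathbb X}_{s,u}\otimes\widehat{\mathbb X}_{u,t}=\widehat{\mathbb X}_{s,t}$ for $s\le u\le t$, and whose level $m$ has finite $p/m$-variation for every $m\ge1$; write $\widehat{\mathbb X}_t:=\widehat{\mathbb X}_{0,t}$. These objects are well defined: the Young integrals exist, $(\widehat X,\widehat{\mathbb X}^{(2)})$ is a continuous $p$-rough path over $\mathbb R^{\hat d}$, and it has a Lyons extension. Define the quasi-shuffle product recursively by $e_I\,\widetilde{\sqcup\!\sqcup}\,e_\emptyset=e_\emptyset\,\widetilde{\sqcup\!\sqcup}\,e_I=e_I$ and, for non-empty words $I,J$ with last letters $i,j$, $$e_I\,\widetilde{\sqcup\!\sqcup}\,e_J=(e_{I'}\,\widetilde{\sqcup\!\sqcup}\,e_J)\otimes e_i+(e_I\,\widetilde{\sqcup\!\sqcup}\,e_{J'})\otimes e_j+(e_{I'}\,\widetilde{\sqcup\!\sqcup}\,e_{J'})\otimes\epsilon_{ij}.$$ Then for all words $I,J$ with letters in $\{0,\dots,\hat d-1\}$ and all $t\in[0,T]$,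 $$\langle e_I,\widehat{\mathbb X}_t\rangle\,\langle e_J,\widehat{\mathbb X}_t\rangle=\langle e_I\,\widetilde{\sqcup\!\sqcup}\,e_J,\widehat{\mathbb X}_t\rangle .$$ -/

import Mathlib

open Filter Topology

noncomputable section

namespace RoughSig

/-! ### Partitions and variation -/

/-- A partition `s = u₀ < u₁ < ⋯ < uₙ = t` of `[s, t]`. -/
structure Partition (s t : ℝ) where
  n : ℕ
  pt : Fin (n + 1) → ℝ
  strictMono : StrictMono pt
  first : pt 0 = s
  last : pt (Fin.last n) = t

/-- The mesh size `max (u_{i+1} - u_i)` (and `0` for the one-point partition of `[s, s]`). -/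
def Partition.mesh {s t : ℝ} (P : Partition s t) : ℝ :=
  ⨆ i : Fin P.n, (P.pt i.succ - P.pt i.castSucc)

/-- The filter describing the limit `mesh → 0` along all partitions of `[s, t]`. -/
def meshZero (s t : ℝ) : Filter (Partition s t) := comap Partition.mesh (𝓝 0)

/-- The `r`-variation over `[s, t]` of a two-parameter function. -/
def variation {E : Type*} [NormedAddCommGroup E] (r : ℝ) (A : ℝ → ℝ → E) (s t : ℝ) : ENNReal :=
  (⨆ P : Partition s t, ∑ i : Fin P.n, ‖A (P.pt i.castSucc) (P.pt i.succ)‖ₑ ^ r) ^ (1 / r)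

/-- The simplex `{(s, t) : 0 ≤ s ≤ t ≤ T}`. -/
def simplex (T : ℝ) : Set (ℝ × ℝ) := {x | 0 ≤ x.1 ∧ x.1 ≤ x.2 ∧ x.2 ≤ T}

/-- `∫_s^t f dg = L` as a Young integral: the left-point Riemann sums converge to `L` as the
mesh of the partition tends to zero. -/
def HasYoungIntegral (f g : ℝ → ℝ) (s t L : ℝ) : Prop :=
  Tendsto (fun P : Partition s t =>
    ∑ i : Fin P.n, f (P.pt i.castSucc) * (g (P.pt i.succ) - g (P.pt i.castSucc)))
    (meshZero s t) (𝓝 L)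

/-! ### Rough paths -/

/-- `(X, 𝕏)` is a continuous `p`-rough path on `[0, T]` over `ℝ^ι`; only the values of `X` on
`[0, T]` and those of `𝕏` on the simplex matter. -/
structure IsRoughPath {ι : Type*} [Fintype ι] (p T : ℝ) (X : ℝ → EuclideanSpace ℝ ι)
    (XX : ℝ → ℝ → EuclideanSpace ℝ (ι × ι)) : Prop where
  continuousOn_fst : ContinuousOn X (Set.Icc 0 T)
  variation_fst : variation p (fun s t => X t - X s) 0 T < ⊤
  continuousOn_snd : ContinuousOn (fun x : ℝ × ℝ => XX x.1 x.2) (simplex T)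
  variation_snd : variation (p / 2) XX 0 T < ⊤
  chen : ∀ s u t : ℝ, 0 ≤ s → s ≤ u → u ≤ t → t ≤ T → ∀ i j : ι,
    XX s t (i, j) = XX s u (i, j) + XX u t (i, j) + (X u i - X s i) * (X t j - X u j)

/-- The bracket `[𝐗]_t = X_{0,t} ⊗ X_{0,t} - (𝕏_{0,t} + 𝕏_{0,t}ᵀ)`. -/
def bracket {ι : Type*} (X : ℝ → EuclideanSpace ℝ ι)
    (XX : ℝ → ℝ → EuclideanSpace ℝ (ι × ι)) (t : ℝ) (i j : ι) : ℝ :=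
  (X t i - X 0 i) * (X t j - X 0 j) - (XX 0 t (i, j) + XX 0 t (j, i))

/-- The index set of the extended path: time, the `d` components of `X`, and the bracket
components `ij` with `i ≤ j`; it has `1 + d + d (d + 1) / 2` elements. -/
inductive ExtIndex (d : ℕ) where
  | time : ExtIndex d
  | path (i : Fin d) : ExtIndex d
  | brack (ij : {ij : Fin d × Fin d // ij.1 ≤ ij.2}) : ExtIndex d
  deriving DecidableEq, Fintype

/-- The extended path `X̂_t = (t, X_t, ([𝐗]^{ij}_t)_{i ≤ j})`. -/
def extPath {d : ℕ} (X : ℝ → EuclideanSpace ℝ (Fin d))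
    (XX : ℝ → ℝ → EuclideanSpace ℝ (Fin d × Fin d)) (t : ℝ) :
    EuclideanSpace ℝ (ExtIndex d) :=
  WithLp.toLp 2 fun a => match a with
    | .time => t
    | .path i => X t i
    | .brack ij => bracket X XX t ij.1.1 ij.1.2

/-- `XXh` is the canonical second level of the extended path: it is `𝕏` on the components of `X`,
and every other component is the Young integral `∫_s^t X̂^a_{s,r} dX̂^b_r`. -/
structure IsExtLift {d : ℕ} (T : ℝ) (X : ℝ → EuclideanSpace ℝ (Fin d))
    (XX : ℝ → ℝ → EuclideanSpace ℝ (Fin d × Fin d))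
    (XXh : ℝ → ℝ → EuclideanSpace ℝ (ExtIndex d × ExtIndex d)) : Prop where
  path_path : ∀ s t : ℝ, 0 ≤ s → s ≤ t → t ≤ T → ∀ i j : Fin d,
    XXh s t (.path i, .path j) = XX s t (i, j)
  young : ∀ s t : ℝ, 0 ≤ s → s ≤ t → t ≤ T → ∀ a b : ExtIndex d,
    ¬ ((∃ i, a = .path i) ∧ ∃ j, b = .path j) →
    HasYoungIntegral (fun r => extPath X XX r a - extPath X XX s a)
      (fun r => extPath X XX r b) s t (XXh s t (a, b))

/-! ### Tensor series and Lyons' extension -/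

/-- Tensor series `T((ℝ^ι))`: the coefficient of `e_I` for each word `I`. -/
abbrev TSeries (ι : Type*) := List ι → ℝ

/-- The product `⊗` of tensor series. -/
def TSeries.tensor {ι : Type*} (a b : TSeries ι) : TSeries ι := fun w =>
  ∑ k ∈ Finset.range (w.length + 1), a (w.take k) * b (w.drop k)

/-- The level-`m` component, an element of `(ℝ^ι)^{⊗ m}` with its Euclidean norm. -/
def TSeries.level {ι : Type*} (m : ℕ) (a : TSeries ι) : EuclideanSpace ℝ (Fin m → ι) :=
  WithLp.toLp 2 fun w => a (List.ofFn w)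

/-- `S` is Lyons' extension of `(1, X, 𝕏)`: a continuous multiplicative functional
`(s, t) ↦ S_{s,t}` with values in `T((ℝ^ι))` that agrees with `(1, X, 𝕏)` up to level two and has
finite `p`-variation, i.e. its level `m` has finite `p/m`-variation for every `m ≥ 1`.
The associated path is `t ↦ S_{0,t}`. -/
structure IsLyonsExtension {ι : Type*} [Fintype ι] (p T : ℝ) (X : ℝ → EuclideanSpace ℝ ι)
    (XX : ℝ → ℝ → EuclideanSpace ℝ (ι × ι)) (S : ℝ → ℝ → TSeries ι) : Prop where
  level_zero : ∀ s t : ℝ, 0 ≤ s → s ≤ t → t ≤ T → S s t [] = 1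
  level_one : ∀ s t : ℝ, 0 ≤ s → s ≤ t → t ≤ T → ∀ i, S s t [i] = X t i - X s i
  level_two : ∀ s t : ℝ, 0 ≤ s → s ≤ t → t ≤ T → ∀ i j, S s t [i, j] = XX s t (i, j)
  chen : ∀ s u t : ℝ, 0 ≤ s → s ≤ u → u ≤ t → t ≤ T → (S s u).tensor (S u t) = S s t
  continuousOn : ∀ w, ContinuousOn (fun x : ℝ × ℝ => S x.1 x.2 w) (simplex T)
  variation_lt_top : ∀ m : ℕ, 1 ≤ m →
    variation (p / m) (fun s t => (S s t).level m) 0 T < ⊤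

/-! ### The tensor algebra and the quasi-shuffle product -/

/-- The tensor algebra `T(ℝ^ι)`, with basis the words; its multiplication is `⊗`. -/
abbrev TAlg (ι : Type*) := MonoidAlgebra ℝ (FreeMonoid ι)

/-- The basis element `e_I`. -/
def e {ι : Type*} (I : List ι) : TAlg ι := MonoidAlgebra.single (FreeMonoid.ofList I) 1

/-- The pairing `⟨ℓ, a⟩` of `ℓ ∈ T(ℝ^ι)` with `a ∈ T((ℝ^ι))`. -/
def pairing {ι : Type*} (l : TAlg ι) (a : TSeries ι) : ℝ :=
  Finsupp.sum l.coeff fun w c => c * a (FreeMonoid.toList w)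

/-- The bracket letter `ε_{ij} = ε_{ji}`, set to `0` unless both indices belong to `X`. -/
def eps {d : ℕ} : ExtIndex d → ExtIndex d → TAlg (ExtIndex d)
  | .path i, .path j => e [.brack ⟨(min i j, max i j), min_le_max⟩]
  | _, _ => 0

/-- The quasi-shuffle recursion on words read from right to left (the head is the last letter). -/
def quasiShuffleRev {d : ℕ} : List (ExtIndex d) → List (ExtIndex d) → TAlg (ExtIndex d)
  | [], J => e J.reverse
  | i :: I, [] => e (i :: I).reverse
  | i :: I, j :: J =>
      quasiShuffleRev I (j :: J) * e [i] + quasiShuffleRev (i :: I) J * e [j]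
        + quasiShuffleRev I J * eps i j
  termination_by I J => I.length + J.length

/-- The quasi-shuffle product of `e_I` and `e_J`. -/
def quasiShuffle {d : ℕ} (I J : List (ExtIndex d)) : TAlg (ExtIndex d) :=
  quasiShuffleRev I.reverse J.reverse

theorem quasiShuffle_nil_left {d : ℕ} (J : List (ExtIndex d)) : quasiShuffle [] J = e J := by
  simp [quasiShuffle, quasiShuffleRev]

theorem quasiShuffle_nil_right {d : ℕ} (I : List (ExtIndex d)) : quasiShuffle I [] = e I := by
  rcases h : I.reverse with _ | ⟨i, I'⟩
  · simp_all [quasiShuffle, quasiShuffleRev]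
  · have h' : I = (i :: I').reverse := by rw [← h, List.reverse_reverse]
    simp only [quasiShuffle, h, List.reverse_nil, quasiShuffleRev]
    rw [h']

theorem quasiShuffle_concat {d : ℕ} (I J : List (ExtIndex d)) (i j : ExtIndex d) :
    quasiShuffle (I ++ [i]) (J ++ [j]) =
      quasiShuffle I (J ++ [j]) * e [i] + quasiShuffle (I ++ [i]) J * e [j]
        + quasiShuffle I J * eps i j := by
  simp [quasiShuffle, quasiShuffleRev]

end RoughSig

end

open Filter Topology

noncomputable section

namespace RoughSig

/-! ### Controls -/

/-! The idea is to count time and bracket letters twice. Brackets have finite `p/2`-variation and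
time has finite variation, so `extWeight` gives weight 1 to the letters of `X` and weight 2 to all
others. A coefficient of weight `k` should then be of order `ω ^ (k / p)` for a control `ω`. Since
`p < 3`, every word of weight at least 3 lies above the sewing threshold. The words of smaller
weight carry only the given data: increments of the extended path and `𝕏` on pairs of `X`-letters.

Existence: starting from these data, `IsWeightedFunctional.exists_extension` sews one weight at a
time and yields a signature with sharp homogeneity. Its two-letter words other than pairs of
`X`-letters have weight at least 3, so their sums over partitions vanish with the mesh. By Chen's
relation these coefficients are then the required Young integrals.

Uniqueness: by induction on length, two Lyons extensions differ at a word of length at least 3 by a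
continuous additive functional of order greater than 1. Such a functional vanishes by
`additive_eq_zero`. It therefore suffices to treat the constructed signature `S`.

The identity: let `D` be the product of the coefficients of two words minus the pairing of `S` with
their quasi-shuffle. Deconcatenation is multiplicative for the quasi-shuffle (`qs_tensor`), so
induction on total length makes `D` additive. The letter `ε_{ij}` is nonzero only for two
`X`-letters and then has weight 2 = 1 + 1, so the quasi-shuffle preserves total weight
(`homBound_qs`) and `D` has the order of that weight. If the weight is at least 3, `D` vanishes by
the same principle. Otherwise the nonempty words are single `X`-letters, and the identity is the
definition of the bracket (`IsExtSignature.path_mul_path`).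

Controls are not assumed continuous. Continuity of the functionals replaces this: a bound by `ω ^ θ`
together with uniform smallness near the diagonal gives an arbitrarily small constant at any smaller
exponent. -/

/-- A finite superadditive function on the simplex; no continuity is required. -/
structure IsControl (T : ℝ) (ω : ℝ → ℝ → ℝ) : Prop where
  nonneg : ∀ s t, 0 ≤ s → s ≤ t → t ≤ T → 0 ≤ ω s t
  superadd : ∀ s u t, 0 ≤ s → s ≤ u → u ≤ t → t ≤ T → ω s u + ω u t ≤ ω s t

namespace IsControl

variable {T : ℝ} {ω ω' : ℝ → ℝ → ℝ}

theorem self_eq_zero (hω : IsControl T ω) {s : ℝ} (h0 : 0 ≤ s) (h1 : s ≤ T) : ω s s = 0 := by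
  have h2 := hω.superadd s s s h0 le_rfl le_rfl h1
  have h3 := hω.nonneg s s h0 le_rfl h1
  linarith

theorem mono (hω : IsControl T ω) {a s t b : ℝ} (h0 : 0 ≤ a) (h1 : a ≤ s) (h2 : s ≤ t) (h3 : t ≤ b)
    (h4 : b ≤ T) : ω s t ≤ ω a b := by
  have e1 := hω.superadd a s b h0 h1 (h2.trans h3) h4
  have e2 := hω.superadd s t b (h0.trans h1) h2 h3 h4
  have e3 := hω.nonneg a s h0 h1 (h2.trans (h3.trans h4))
  have e4 := hω.nonneg t b (h0.trans (h1.trans h2)) h3 h4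
  linarith

theorem add (hω : IsControl T ω) (hω' : IsControl T ω') :
    IsControl T (fun s t => ω s t + ω' s t) where
  nonneg s t h0 h1 h2 := add_nonneg (hω.nonneg s t h0 h1 h2) (hω'.nonneg s t h0 h1 h2)
  superadd s u t h0 h1 h2 h3 := by
    have := hω.superadd s u t h0 h1 h2 h3
    have := hω'.superadd s u t h0 h1 h2 h3
    linarith

theorem sub_time (T : ℝ) : IsControl T (fun s t => t - s) where
  nonneg s t _ h1 _ := by linarith
  superadd s u t _ _ _ _ := by linarith

/-- Powers of a control with a larger exponent are dominated by those with a smaller one. -/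
theorem rpow_le (hω : IsControl T ω) (hT : 0 ≤ T) {x y : ℝ} (hx : 0 ≤ x) (hxy : x ≤ y) :
    ∃ C, 0 ≤ C ∧ ∀ s t, 0 ≤ s → s ≤ t → t ≤ T → ω s t ^ y ≤ C * ω s t ^ x := by
  have hM := hω.nonneg 0 T le_rfl hT le_rfl
  refine ⟨ω 0 T ^ (y - x), Real.rpow_nonneg hM _, fun s t h0 h1 h2 => ?_⟩
  have h3 := hω.nonneg s t h0 h1 h2
  have h4 := hω.mono le_rfl h0 h1 h2 le_rfl
  calc ω s t ^ y = ω s t ^ ((y - x) + x) := by ring_nf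
    _ = ω s t ^ (y - x) * ω s t ^ x := Real.rpow_add_of_nonneg h3 (by linarith) hx
    _ ≤ _ := by
      gcongr

theorem sum_le (hω : IsControl T ω) : ∀ (n : ℕ) (pt : Fin (n + 1) → ℝ), Monotone pt →
    0 ≤ pt 0 → pt (Fin.last n) ≤ T →
    ∑ i : Fin n, ω (pt i.castSucc) (pt i.succ) ≤ ω (pt 0) (pt (Fin.last n))
  | 0, pt, _, h0, h1 => by simpa using hω.nonneg _ _ h0 le_rfl h1
  | n + 1, pt, hm, h0, h1 => by
    rw [Fin.sum_univ_castSucc]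
    have ih := sum_le hω n (fun i => pt i.castSucc) (hm.comp Fin.strictMono_castSucc.monotone)
      h0 ((hm (Fin.le_last _)).trans h1)
    have := hω.superadd (pt 0) (pt (Fin.last n).castSucc) (pt (Fin.last (n + 1))) h0
      (hm (Fin.zero_le _)) (hm (Fin.le_last _)) h1
    simp only [Fin.succ_castSucc, Fin.succ_last] at ih ⊢
    refine le_trans (add_le_add ih le_rfl) ?_
    simpa using this

theorem sum_partition_le (hω : IsControl T ω) {s t : ℝ} (h0 : 0 ≤ s) (h1 : t ≤ T)
    (P : Partition s t) : ∑ i : Fin P.n, ω (P.pt i.castSucc) (P.pt i.succ) ≤ ω s t := by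
  have := hω.sum_le P.n P.pt P.strictMono.monotone (by rw [P.first]; exact h0)
    (by rw [P.last]; exact h1)
  rwa [P.first, P.last] at this

end IsControl

theorem Partition.mem_Icc {s t : ℝ} (P : Partition s t) (i : Fin (P.n + 1)) :
    s ≤ P.pt i ∧ P.pt i ≤ t :=
  ⟨P.first.symm.trans_le (P.strictMono.monotone (Fin.zero_le _)),
    (P.strictMono.monotone (Fin.le_last _)).trans_eq P.last⟩

theorem Partition.le_mesh {s t : ℝ} (P : Partition s t) (i : Fin P.n) :
    P.pt i.succ - P.pt i.castSucc ≤ P.mesh :=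
  le_ciSup (f := fun i : Fin P.n => P.pt i.succ - P.pt i.castSucc) (Set.finite_range _).bddAbove i

/-! ### Smallness near the diagonal -/

/-- Interpolation: a bound by `ω ^ θ` together with smallness improves the constant for any
smaller exponent. -/
theorem exists_small_rpow {K θ θ' : ℝ} (hK : 0 ≤ K) (hθ' : 0 ≤ θ') (hθ : θ' < θ) {η : ℝ}
    (hη : 0 < η) : ∃ ε > 0, ∀ x w : ℝ, 0 ≤ w → |x| ≤ K * w ^ θ → |x| ≤ ε → |x| ≤ η * w ^ θ' := by
  have hlt : 0 < θ - θ' := by linarith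
  set c : ℝ := (η / (K + 1)) ^ (1 / (θ - θ')) with hc
  have hq : 0 < η / (K + 1) := by positivity
  have hc0 : 0 < c := Real.rpow_pos_of_pos hq _
  -- Below the threshold `c` the surplus power of `w` absorbs `K`; above it `η * w ^ θ'` already
  -- exceeds this `ε`.
  refine ⟨η * c ^ θ', by positivity, fun x w hw h1 h2 => ?_⟩
  rcases le_total w c with h | h
  · refine h1.trans ?_
    have e1 : w ^ (θ - θ') ≤ η / (K + 1) := by
      calc w ^ (θ - θ') ≤ c ^ (θ - θ') := Real.rpow_le_rpow hw h hlt.le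
        _ = η / (K + 1) := by
          rw [hc, ← Real.rpow_mul hq.le, one_div, inv_mul_cancel₀ hlt.ne', Real.rpow_one]
    have e2 : w ^ θ = w ^ (θ - θ') * w ^ θ' := by
      rw [← Real.rpow_add_of_nonneg hw hlt.le hθ']; ring_nf
    have e3 : K * w ^ (θ - θ') ≤ η := by
      calc K * w ^ (θ - θ') ≤ K * (η / (K + 1)) := by gcongr
        _ = η * (K / (K + 1)) := by ring
        _ ≤ η * 1 := by
          gcongr
          rw [div_le_one (by positivity)]; linarith
        _ = η := mul_one _
    rw [e2, ← mul_assoc]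
    have := Real.rpow_nonneg hw θ'
    gcongr
  · refine h2.trans ?_
    gcongr

/-- A two-parameter function that tends to zero uniformly at the diagonal. -/
def SmallDiag (T : ℝ) (A : ℝ → ℝ → ℝ) : Prop :=
  ∀ ε > 0, ∃ δ > 0, ∀ s t, 0 ≤ s → s ≤ t → t ≤ T → t - s < δ → |A s t| ≤ ε

theorem isCompact_simplex (T : ℝ) : IsCompact (simplex T) := by
  have hc : IsClosed (simplex T) := by
    apply IsClosed.inter (isClosed_le continuous_const continuous_fst)
    exact IsClosed.inter (isClosed_le continuous_fst continuous_snd)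
      (isClosed_le continuous_snd continuous_const)
  refine ((isCompact_Icc (a := (0 : ℝ)) (b := T)).prod
    (isCompact_Icc (a := (0 : ℝ)) (b := T))).of_isClosed_subset hc ?_
  rintro ⟨s, t⟩ ⟨h0, h1, h2⟩
  simp only at h0 h1 h2
  exact ⟨⟨h0, h1.trans h2⟩, ⟨h0.trans h1, h2⟩⟩

theorem SmallDiag.of_continuousOn {T : ℝ} {A : ℝ → ℝ → ℝ}
    (hA : ContinuousOn (fun x : ℝ × ℝ => A x.1 x.2) (simplex T))
    (h0 : ∀ s, 0 ≤ s → s ≤ T → A s s = 0) : SmallDiag T A := by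
  intro ε hε
  have hu := (isCompact_simplex T).uniformContinuousOn_of_continuous hA
  rw [Metric.uniformContinuousOn_iff] at hu
  obtain ⟨δ, hδ, H⟩ := hu ε hε
  refine ⟨δ, hδ, fun s t hs hst ht hlt => ?_⟩
  have := H (s, t) ⟨hs, hst, ht⟩ (s, s) ⟨hs, le_rfl, hst.trans ht⟩ (by
    simp only [Prod.dist_eq, dist_self, Real.dist_eq]
    rw [abs_of_nonneg (by linarith)]
    simpa using ⟨hδ, hlt⟩)
  simp only [h0 s hs (hst.trans ht), Real.dist_eq, sub_zero] at this
  exact this.le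

/-- This takes the place of continuity of the control: the surplus exponent `θ - 1` is traded for a
small factor in front of a superadditive bound, which can be summed over partitions. -/
theorem SmallDiag.le_mul_control {T : ℝ} {A ω : ℝ → ℝ → ℝ} (hω : IsControl T ω)
    (hA : SmallDiag T A) {C θ : ℝ} (hθ : 1 < θ) (hC : 0 ≤ C)
    (hb : ∀ s t, 0 ≤ s → s ≤ t → t ≤ T → |A s t| ≤ C * ω s t ^ θ) {η : ℝ} (hη : 0 < η) :
    ∃ δ > 0, ∀ s t, 0 ≤ s → s ≤ t → t ≤ T → t - s < δ → |A s t| ≤ η * ω s t := by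
  obtain ⟨ε, hε, H⟩ := exists_small_rpow hC zero_le_one hθ hη
  obtain ⟨δ, hδ, H'⟩ := hA ε hε
  refine ⟨δ, hδ, fun s t h0 h1 h2 h3 => ?_⟩
  simpa using H _ _ (hω.nonneg s t h0 h1 h2) (hb s t h0 h1 h2) (H' s t h0 h1 h2 h3)

/-- Sums over partitions of a superlinear remainder vanish as the mesh tends to zero. -/
theorem tendsto_sum_meshZero {T : ℝ} {A ω : ℝ → ℝ → ℝ} (hω : IsControl T ω)
    (hA : SmallDiag T A) {C θ : ℝ} (hθ : 1 < θ) (hC : 0 ≤ C)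
    (hb : ∀ s t, 0 ≤ s → s ≤ t → t ≤ T → |A s t| ≤ C * ω s t ^ θ) {s t : ℝ} (h0 : 0 ≤ s)
    (hst : s ≤ t) (h1 : t ≤ T) :
    Tendsto (fun P : Partition s t => ∑ i : Fin P.n, A (P.pt i.castSucc) (P.pt i.succ))
      (meshZero s t) (𝓝 0) := by
  rw [Metric.tendsto_nhds]
  intro ε hε
  have hw := hω.nonneg s t h0 hst h1
  obtain ⟨δ, hδ, H⟩ := hA.le_mul_control hω hθ hC hb (η := ε / (2 * (ω s t + 1))) (by positivity)
  have : ∀ᶠ P : Partition s t in meshZero s t, P.mesh < δ :=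
    tendsto_comap.eventually (gt_mem_nhds hδ)
  filter_upwards [this] with P hP
  rw [Real.dist_eq, sub_zero]
  calc |∑ i : Fin P.n, A (P.pt i.castSucc) (P.pt i.succ)|
      ≤ ∑ i : Fin P.n, |A (P.pt i.castSucc) (P.pt i.succ)| := Finset.abs_sum_le_sum_abs _ _
    _ ≤ ∑ i : Fin P.n, ε / (2 * (ω s t + 1)) * ω (P.pt i.castSucc) (P.pt i.succ) := by
      refine Finset.sum_le_sum fun i _ => H _ _ (h0.trans (P.mem_Icc _).1)
        (P.strictMono.monotone i.castSucc_lt_succ.le) ((P.mem_Icc _).2.trans h1)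
        ((P.le_mesh i).trans_lt hP)
    _ = ε / (2 * (ω s t + 1)) * ∑ i : Fin P.n, ω (P.pt i.castSucc) (P.pt i.succ) := by
      rw [Finset.mul_sum]
    _ ≤ ε / (2 * (ω s t + 1)) * ω s t := by
      gcongr
      exact hω.sum_partition_le h0 h1 P
    _ < ε := by
      rw [div_mul_eq_mul_div, div_lt_iff₀ (by positivity)]
      nlinarith

/-- The partition of `[s, t]` into `n + 1` intervals of equal length. -/
def Partition.uniform {s t : ℝ} (hst : s < t) (n : ℕ) : Partition s t where
  n := n + 1
  pt i := s + i * ((t - s) / (n + 1))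
  strictMono := by
    intro i j hij
    have h : ((i : ℕ) : ℝ) < ((j : ℕ) : ℝ) := by exact_mod_cast hij
    have h2 : 0 < (t - s) / ((n : ℝ) + 1) := div_pos (by linarith) (by positivity)
    simp only
    nlinarith
  first := by simp
  last := by
    have : (n : ℝ) + 1 ≠ 0 := by positivity
    simp only [Fin.val_last]
    push_cast
    field_simp
    ring

theorem Partition.mesh_uniform {s t : ℝ} (hst : s < t) (n : ℕ) :
    (Partition.uniform hst n).mesh = (t - s) / (n + 1) := by
  have h : ∀ i : Fin (n + 1), (uniform hst n).pt i.succ - (uniform hst n).pt i.castSucc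
      = (t - s) / (n + 1) := by
    intro i
    simp only [uniform, Fin.val_succ, Fin.val_castSucc]
    push_cast
    ring
  have h' : (uniform hst n).mesh = ⨆ _ : Fin (n + 1), (t - s) / ((n : ℝ) + 1) := iSup_congr h
  rw [h', ciSup_const]

/-- Needed for uniqueness of limits along `meshZero`. Uniform partitions have arbitrarily small
mesh; for `s = t` the one-point partition has mesh 0, the supremum over an empty type. -/
theorem meshZero_neBot {s t : ℝ} (hst : s ≤ t) : (meshZero s t).NeBot := by
  rw [meshZero, comap_neBot_iff]
  intro U hU
  rcases hst.eq_or_lt with rfl | hlt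
  · refine ⟨⟨0, fun _ => s, fun i j h => absurd h (by omega), rfl, rfl⟩, ?_⟩
    simp only [Partition.mesh, Real.iSup_of_isEmpty]
    exact mem_of_mem_nhds hU
  · have h1 : Tendsto (fun n : ℕ => (t - s) / ((n : ℝ) + 1)) atTop (𝓝 0) := by
      have := (tendsto_one_div_add_atTop_nhds_zero_nat (𝕜 := ℝ)).const_mul (t - s)
      simpa [div_eq_mul_inv] using this
    obtain ⟨n, hn⟩ := (h1.eventually hU).exists
    exact ⟨Partition.uniform hlt n, by rwa [Partition.mesh_uniform]⟩

/-- Additive functionals along partitions. -/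
theorem sum_additive {T : ℝ} {D : ℝ → ℝ → ℝ}
    (hadd : ∀ s u t, 0 ≤ s → s ≤ u → u ≤ t → t ≤ T → D s t = D s u + D u t) :
    ∀ (n : ℕ) (pt : Fin (n + 1) → ℝ), Monotone pt → 0 ≤ pt 0 → pt (Fin.last n) ≤ T →
    ∑ i : Fin n, D (pt i.castSucc) (pt i.succ) = D (pt 0) (pt (Fin.last n))
  | 0, pt, _, h0, h1 => by
    have := hadd _ _ _ h0 le_rfl le_rfl h1
    simp only [Finset.univ_eq_empty, Finset.sum_empty]
    have e : Fin.last 0 = 0 := rfl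
    rw [e] at *
    linarith
  | n + 1, pt, hm, h0, h1 => by
    rw [Fin.sum_univ_castSucc]
    have ih := sum_additive hadd n (fun i => pt i.castSucc)
      (hm.comp Fin.strictMono_castSucc.monotone) h0 ((hm (Fin.le_last _)).trans h1)
    have := hadd (pt 0) (pt (Fin.last n).castSucc) (pt (Fin.last (n + 1))) h0
      (hm (Fin.zero_le _)) (hm (Fin.le_last _)) h1
    simp only [Fin.succ_castSucc, Fin.succ_last] at ih ⊢
    rw [ih]
    simpa using this.symm

theorem sum_partition_additive {T : ℝ} {D : ℝ → ℝ → ℝ}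
    (hadd : ∀ s u t, 0 ≤ s → s ≤ u → u ≤ t → t ≤ T → D s t = D s u + D u t) {s t : ℝ}
    (h0 : 0 ≤ s) (h1 : t ≤ T) (P : Partition s t) :
    ∑ i : Fin P.n, D (P.pt i.castSucc) (P.pt i.succ) = D s t := by
  have := sum_additive hadd P.n P.pt P.strictMono.monotone (by rw [P.first]; exact h0)
    (by rw [P.last]; exact h1)
  rwa [P.first, P.last] at this

/-- A continuous additive functional with a superlinear bound vanishes. -/
theorem additive_eq_zero {T : ℝ} {D ω : ℝ → ℝ → ℝ} (hω : IsControl T ω)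
    (hadd : ∀ s u t, 0 ≤ s → s ≤ u → u ≤ t → t ≤ T → D s t = D s u + D u t)
    (hc : ContinuousOn (fun x : ℝ × ℝ => D x.1 x.2) (simplex T)) {C θ : ℝ} (hθ : 1 < θ)
    (hC : 0 ≤ C) (hb : ∀ s t, 0 ≤ s → s < t → t ≤ T → |D s t| ≤ C * ω s t ^ θ) {s t : ℝ}
    (h0 : 0 ≤ s) (hst : s ≤ t) (h1 : t ≤ T) : D s t = 0 := by
  have hself : ∀ s, 0 ≤ s → s ≤ T → D s s = 0 := fun s h0 h1 => by
    have := hadd s s s h0 le_rfl le_rfl h1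
    linarith
  have hb' : ∀ s t, 0 ≤ s → s ≤ t → t ≤ T → |D s t| ≤ C * ω s t ^ θ := fun s t h0 hst h1 => by
    rcases hst.eq_or_lt with rfl | h
    · rw [hself s h0 h1, abs_zero]
      exact mul_nonneg hC (Real.rpow_nonneg (hω.nonneg s s h0 le_rfl h1) _)
    · exact hb s t h0 h h1
  -- By additivity the sums over all partitions equal `D s t`, so their limit 0 is its value.
  have hlim := tendsto_sum_meshZero hω (SmallDiag.of_continuousOn hc hself) hθ hC hb' h0 hst h1
  simp only [sum_partition_additive hadd h0 h1] at hlim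
  have := meshZero_neBot hst
  exact tendsto_nhds_unique tendsto_const_nhds hlim

/-! ### The sewing lemma -/

/-- The set of ordered triples in `[0, T]`. -/
def simplex₃ (T : ℝ) : Set (ℝ × ℝ × ℝ) := {x | 0 ≤ x.1 ∧ x.1 ≤ x.2.1 ∧ x.2.1 ≤ x.2.2 ∧ x.2.2 ≤ T}

theorem isCompact_simplex₃ (T : ℝ) : IsCompact (simplex₃ T) := by
  have hc : IsClosed (simplex₃ T) := by
    have h1 : Continuous fun x : ℝ × ℝ × ℝ => x.2.1 := by fun_prop
    have h2 : Continuous fun x : ℝ × ℝ × ℝ => x.2.2 := by fun_prop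
    exact (isClosed_le continuous_const continuous_fst).inter
      ((isClosed_le continuous_fst h1).inter
        ((isClosed_le h1 h2).inter (isClosed_le h2 continuous_const)))
  refine ((isCompact_Icc (a := (0 : ℝ)) (b := T)).prod
    ((isCompact_Icc (a := (0 : ℝ)) (b := T)).prod
      (isCompact_Icc (a := (0 : ℝ)) (b := T)))).of_isClosed_subset hc ?_
  rintro ⟨s, u, t⟩ ⟨h0, h1, h2, h3⟩
  simp only at h0 h1 h2 h3
  exact ⟨⟨h0, by linarith⟩, ⟨by linarith, by linarith⟩, ⟨by linarith, h3⟩⟩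

/-- A function on a finite set of times with prescribed increments over neighbouring times. -/
theorem exists_increments (Ξ : ℝ → ℝ → ℝ) (F : Finset ℝ) :
    ∃ φ : ℝ → ℝ, ∀ u ∈ F, ∀ v ∈ F, u < v → (∀ x ∈ F, u < x → v ≤ x) → φ v - φ u = Ξ u v := by
  induction F using Finset.induction_on_max with
  | empty => exact ⟨0, by simp⟩
  | insert a F ha ih =>
    obtain ⟨φ, hφ⟩ := ih
    have hne : ∀ x ∈ F, x ≠ a := fun x hx => (ha x hx).ne
    rcases F.eq_empty_or_nonempty with rfl | hF
    · refine ⟨φ, fun u hu v hv huv => ?_⟩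
      simp only [insert_empty_eq, Finset.mem_singleton] at hu hv
      subst hu hv
      exact absurd huv (lt_irrefl _)
    · refine ⟨Function.update φ a (φ (F.max' hF) + Ξ (F.max' hF) a), fun u hu v hv huv hn => ?_⟩
      have huF : u ∈ F := by
        rcases Finset.mem_insert.1 hu with rfl | h
        · rcases Finset.mem_insert.1 hv with rfl | h'
          · exact absurd huv (lt_irrefl _)
          · exact absurd huv (ha v h').le.not_gt
        · exact h
      rcases Finset.mem_insert.1 hv with rfl | hvF
      · have : u = F.max' hF := by
          refine le_antisymm (F.le_max' u huF) (not_lt.1 fun h => ?_)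
          have := hn _ (Finset.mem_insert_of_mem (F.max'_mem hF)) h
          exact absurd (ha _ (F.max'_mem hF)) this.not_gt
        subst this
        rw [Function.update_self, Function.update_of_ne (hne _ huF)]
        ring
      · rw [Function.update_of_ne (hne _ huF), Function.update_of_ne (hne _ hvF)]
        exact hφ u huF v hvF huv fun x hx => hn x (Finset.mem_insert_of_mem hx)

/-- The constant of the sewing lemma. -/
def sewConst (θ : ℝ) : ℝ := 2 / (1 - 2 * (1 / 2 : ℝ) ^ θ)

theorem two_mul_half_rpow_lt_one {θ : ℝ} (hθ : 1 < θ) : 2 * (1 / 2 : ℝ) ^ θ < 1 := by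
  have h := Real.rpow_lt_rpow_of_exponent_gt (x := (1 / 2 : ℝ)) (by norm_num) (by norm_num) hθ
  rw [Real.rpow_one] at h
  linarith

theorem sewConst_pos {θ : ℝ} (hθ : 1 < θ) : 0 < sewConst θ :=
  div_pos two_pos (by linarith [two_mul_half_rpow_lt_one hθ])

/-- The constant is the fixed point of the bisection recursion: each of the two halves costs a
factor `(1/2) ^ θ`, and two values of `h` add 2. -/
theorem sewConst_eq {θ : ℝ} (hθ : 1 < θ) :
    2 * (sewConst θ * (1 / 2 : ℝ) ^ θ) + 2 = sewConst θ := by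
  have h := two_mul_half_rpow_lt_one hθ
  have h' : 1 - 2 * (1 / 2 : ℝ) ^ θ ≠ 0 := by linarith
  unfold sewConst
  generalize (1 / 2 : ℝ) ^ θ = x at *
  field_simp
  ring

/-- The maximal inequality on a finite set of times. -/
theorem abs_le_of_finset {T : ℝ} {ω A : ℝ → ℝ → ℝ} {h : ℝ → ℝ → ℝ → ℝ} (hω : IsControl T ω)
    {a b K θ : ℝ} (ha : 0 ≤ a) (hb : b ≤ T) (hθ : 1 < θ) (hK : 0 ≤ K)
    (hh : ∀ s u t, a ≤ s → s ≤ u → u ≤ t → t ≤ b → |h s u t| ≤ K * ω s t ^ θ) (F : Finset ℝ)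
    (hA : ∀ s ∈ F, ∀ u ∈ F, ∀ t ∈ F, a ≤ s → s ≤ u → u ≤ t → t ≤ b →
      A s t = A s u + A u t + h s u t)
    (hA0 : ∀ u ∈ F, ∀ v ∈ F, a ≤ u → v ≤ b → u < v → (∀ x ∈ F, u < x → v ≤ x) → A u v = 0) :
    ∀ (n : ℕ) (s t : ℝ), (F.filter fun x => s < x ∧ x < t).card ≤ n → s ∈ F → t ∈ F → a ≤ s →
      s ≤ t → t ≤ b → |A s t| ≤ sewConst θ * K * ω s t ^ θ := by
  have hθ0 : θ ≠ 0 := by linarith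
  have hself : ∀ s ∈ F, a ≤ s → s ≤ b → A s s = 0 := by
    intro s hs h0 h1
    have e1 := hA s hs s hs s hs h0 le_rfl le_rfl h1
    have e2 := hh s s s h0 le_rfl le_rfl h1
    rw [hω.self_eq_zero (ha.trans h0) (h1.trans hb), Real.zero_rpow hθ0, mul_zero] at e2
    have e3 := abs_eq_zero.1 (le_antisymm e2 (abs_nonneg _))
    linarith
  have hC := sewConst_pos hθ
  intro n
  induction n with
  | zero =>
    intro s t hcard hs ht has hst htb
    have hnn := hω.nonneg s t (ha.trans has) hst (htb.trans hb)
    have : A s t = 0 := by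
      rcases hst.eq_or_lt with rfl | hlt
      · exact hself s hs has htb
      · refine hA0 s hs t ht has htb hlt fun x hx hsx => not_lt.1 fun hxt => ?_
        have : x ∈ F.filter fun x => s < x ∧ x < t := by simp [hx, hsx, hxt]
        rw [Finset.card_eq_zero.1 (Nat.le_zero.1 hcard)] at this
        exact absurd this (Finset.notMem_empty x)
    rw [this, abs_zero]
    positivity
  | succ n ih =>
    intro s t hcard hs ht has hst htb
    have h0s := ha.trans has
    have htT := htb.trans hb
    have hnn := hω.nonneg s t h0s hst htT
    rcases hst.eq_or_lt with rfl | hlt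
    · rw [hself s hs has htb, abs_zero]
      positivity
    classical
    -- Bisection by the control: `u` is the last time of `F` before `t` with `ω s u ≤ ω s t / 2`,
    -- and `v` is its successor in `F`. Superadditivity gives `ω v t ≤ ω s t / 2`, and `A u v = 0`
    -- because `u` and `v` are neighbours.
    set G := F.filter fun x => s ≤ x ∧ x < t ∧ ω s x ≤ ω s t / 2 with hG
    have hsG : s ∈ G := by
      simp only [hG, Finset.mem_filter]
      refine ⟨hs, le_rfl, hlt, ?_⟩
      rw [hω.self_eq_zero h0s (hst.trans htT)]
      linarith
    set u := G.max' ⟨s, hsG⟩ with hu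
    have huG : u ∈ G := G.max'_mem _
    obtain ⟨huF, hsu, hut, hωu⟩ : u ∈ F ∧ s ≤ u ∧ u < t ∧ ω s u ≤ ω s t / 2 := by
      simpa [hG] using huG
    set H := F.filter fun x => u < x ∧ x ≤ t with hH
    have htH : t ∈ H := by simp [hH, ht, hut]
    set v := H.min' ⟨t, htH⟩ with hv
    have hvH : v ∈ H := H.min'_mem _
    obtain ⟨hvF, huv, hvt⟩ : v ∈ F ∧ u < v ∧ v ≤ t := by simpa [hH] using hvH
    have hAuv : A u v = 0 := by
      refine hA0 u huF v hvF (has.trans hsu) (hvt.trans htb) huv fun x hx hux => ?_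
      rcases le_total x t with hxt | hxt
      · exact H.min'_le x (by simp [hH, hx, hux, hxt])
      · exact hvt.trans hxt
    have hωv : ω v t ≤ ω s t / 2 := by
      rcases hvt.eq_or_lt with h | h
      · rw [h, hω.self_eq_zero (h0s.trans hst) htT]
        linarith
      · have hsv : ω s t / 2 < ω s v := by
          by_contra hcon
          have : v ∈ G := by
            simp only [hG, Finset.mem_filter]
            exact ⟨hvF, hsu.trans huv.le, h, not_lt.1 hcon⟩
          exact absurd (G.le_max' v this) huv.not_ge
        have := hω.superadd s v t h0s (hsu.trans huv.le) hvt htT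
        linarith
    have hhalf : ∀ w, 0 ≤ w → w ≤ ω s t / 2 →
        sewConst θ * K * w ^ θ ≤ sewConst θ * K * ((1 / 2 : ℝ) ^ θ * ω s t ^ θ) := by
      intro w hw hw2
      rw [← Real.mul_rpow (by norm_num) hnn]
      have : w ≤ 1 / 2 * ω s t := by linarith
      gcongr
    have b1 : |A s u| ≤ sewConst θ * K * ((1 / 2 : ℝ) ^ θ * ω s t ^ θ) := by
      rcases hsu.eq_or_lt with h | h
      · rw [← h, hself s hs has (hst.trans htb), abs_zero]
        positivity
      · refine (ih s u ?_ hs huF has hsu (hut.le.trans htb)).trans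
          (hhalf _ (hω.nonneg s u h0s hsu (hut.le.trans htT)) hωu)
        have : (F.filter fun x => s < x ∧ x < u) ⊂ F.filter fun x => s < x ∧ x < t := by
          rw [Finset.ssubset_iff_of_subset]
          · exact ⟨u, by simp [huF, h, hut], by simp⟩
          · intro x hx
            simp only [Finset.mem_filter] at hx ⊢
            exact ⟨hx.1, hx.2.1, hx.2.2.trans hut⟩
        have := Finset.card_lt_card this
        omega
    have b2 : |A v t| ≤ sewConst θ * K * ((1 / 2 : ℝ) ^ θ * ω s t ^ θ) := by
      have hsv := hsu.trans_lt huv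
      rcases hvt.eq_or_lt with h | h
      · rw [h, hself t ht (has.trans hst) htb, abs_zero]
        positivity
      · refine (ih v t ?_ hvF ht (has.trans hsv.le) hvt htb).trans
          (hhalf _ (hω.nonneg v t (h0s.trans hsv.le) hvt htT) hωv)
        have : (F.filter fun x => v < x ∧ x < t) ⊂ F.filter fun x => s < x ∧ x < t := by
          rw [Finset.ssubset_iff_of_subset]
          · exact ⟨v, by simp [hvF, h, hsv], by simp⟩
          · intro x hx
            simp only [Finset.mem_filter] at hx ⊢
            exact ⟨hx.1, hsv.trans hx.2.1, hx.2.2⟩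
        have := Finset.card_lt_card this
        omega
    have b3 : |h s v t| ≤ K * ω s t ^ θ := hh s v t has (hsu.trans huv.le) hvt htb
    have b4 : |h s u v| ≤ K * ω s t ^ θ := by
      refine (hh s u v has hsu huv.le (hvt.trans htb)).trans ?_
      have := hω.mono h0s le_rfl (hsu.trans huv.le) hvt htT
      have := hω.nonneg s v h0s (hsu.trans huv.le) (hvt.trans htT)
      gcongr
    have e1 := hA s hs v hvF t ht has (hsu.trans huv.le) hvt htb
    have e2 := hA s hs u huF v hvF has hsu huv.le (hvt.trans htb)
    have e3 : A s t = A s u + A v t + h s u v + h s v t := by rw [e1, e2, hAuv]; ring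
    have e4 : |A s t| ≤ |A s u| + |A v t| + |h s u v| + |h s v t| := by
      rw [e3]
      exact (abs_add_le _ _).trans (add_le_add ((abs_add_le _ _).trans
        (add_le_add (abs_add_le _ _) le_rfl)) le_rfl)
    calc |A s t| ≤ _ := e4
      _ ≤ sewConst θ * K * ((1 / 2 : ℝ) ^ θ * ω s t ^ θ)
          + sewConst θ * K * ((1 / 2 : ℝ) ^ θ * ω s t ^ θ) + K * ω s t ^ θ + K * ω s t ^ θ := by
        gcongr
      _ = (2 * (sewConst θ * (1 / 2 : ℝ) ^ θ) + 2) * K * ω s t ^ θ := by ring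
      _ = _ := by rw [sewConst_eq hθ]

/-- Solving `δ A = h` for a cocycle `h` with a superlinear bound. The bound on `A` is local. -/
theorem exists_sewing {T : ℝ} {ω : ℝ → ℝ → ℝ} {h : ℝ → ℝ → ℝ → ℝ} (hω : IsControl T ω)
    (hcoc : ∀ s u v t, 0 ≤ s → s ≤ u → u ≤ v → v ≤ t → t ≤ T →
      h s u v + h s v t = h s u t + h u v t)
    {K θ : ℝ} (hθ : 1 < θ) (hK : 0 ≤ K)
    (hh : ∀ s u t, 0 ≤ s → s ≤ u → u ≤ t → t ≤ T → |h s u t| ≤ K * ω s t ^ θ) :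
    ∃ A : ℝ → ℝ → ℝ,
      (∀ s u t, 0 ≤ s → s ≤ u → u ≤ t → t ≤ T → A s t = A s u + A u t + h s u t) ∧
      ∀ a b K' θ', 0 ≤ a → a ≤ b → b ≤ T → 1 < θ' → 0 ≤ K' →
        (∀ s u t, a ≤ s → s ≤ u → u ≤ t → t ≤ b → |h s u t| ≤ K' * ω s t ^ θ') →
        |A a b| ≤ sewConst θ' * K' * ω a b ^ θ' := by
  -- By the cocycle identity `-h 0 s t` is already a solution; adding increments of a path keeps it
  -- one. The path `φ F` is chosen so that the solution vanishes on neighbours in `F`, as the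
  -- maximal inequality requires.
  choose φ hφ using exists_increments (fun s t => h 0 s t)
  set AF : Finset ℝ → ℝ → ℝ → ℝ := fun F s t => φ F t - φ F s - h 0 s t with hAF
  have hid : ∀ F s u t, 0 ≤ s → s ≤ u → u ≤ t → t ≤ T →
      AF F s t = AF F s u + AF F u t + h s u t := by
    intro F s u t h0 h1 h2 h3
    have := hcoc 0 s u t le_rfl h0 h1 h2 h3
    simp only [hAF]
    linarith
  have hbd : ∀ a b K' θ', 0 ≤ a → a ≤ b → b ≤ T → 1 < θ' → 0 ≤ K' →
      (∀ s u t, a ≤ s → s ≤ u → u ≤ t → t ≤ b → |h s u t| ≤ K' * ω s t ^ θ') →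
      ∀ F : Finset ℝ, a ∈ F → b ∈ F → |AF F a b| ≤ sewConst θ' * K' * ω a b ^ θ' := by
    intro a b K' θ' ha hab hb hθ' hK' hh' F haF hbF
    refine abs_le_of_finset hω ha hb hθ' hK' hh' F
      (fun s _ u _ t _ h0 h1 h2 h3 => hid F s u t (ha.trans h0) h1 h2 (h3.trans hb))
      (fun u hu v hv _ _ huv hn => ?_) _ a b le_rfl haF hbF le_rfl hab le_rfl
    simp only [hAF]
    rw [hφ F u hu v hv huv hn, sub_self]
  -- The maximal inequality is uniform in `F`, so by compactness every value converges along one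
  -- ultrafilter finer than `atTop`. The identity and all local bounds pass to this common limit.
  let L : Ultrafilter (Finset ℝ) := Ultrafilter.of atTop
  have hL : (L : Filter (Finset ℝ)) ≤ atTop := Ultrafilter.of_le atTop
  have hmem : ∀ x : ℝ, ∀ᶠ F : Finset ℝ in L, x ∈ F := fun x =>
    hL ((eventually_ge_atTop {x}).mono fun F hF => hF (Finset.mem_singleton_self x))
  have hlim : ∀ s t, ∃ y, 0 ≤ s → s ≤ t → t ≤ T → Tendsto (fun F => AF F s t) L (𝓝 y) := by
    intro s t
    by_cases hst : 0 ≤ s ∧ s ≤ t ∧ t ≤ T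
    · obtain ⟨h0, h1, h2⟩ := hst
      set B := sewConst θ * K * ω s t ^ θ
      have : ∀ᶠ F in (L.map fun F => AF F s t : Ultrafilter ℝ), F ∈ Set.Icc (-B) B := by
        change ∀ᶠ F in L, AF F s t ∈ Set.Icc (-B) B
        filter_upwards [hmem s, hmem t] with F hs ht
        exact abs_le.1 (hbd s t K θ h0 h1 h2 hθ hK
          (fun s' u' t' h0' h1' h2' h3' => hh _ _ _ (h0.trans h0') h1' h2' (h3'.trans h2)) F hs ht)
      obtain ⟨y, -, hy⟩ := isCompact_Icc.ultrafilter_le_nhds _ (le_principal_iff.2 this)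
      exact ⟨y, fun _ _ _ => hy⟩
    · exact ⟨0, fun h0 h1 h2 => absurd ⟨h0, h1, h2⟩ hst⟩
  choose A hA using hlim
  refine ⟨A, fun s u t h0 h1 h2 h3 => ?_, fun a b K' θ' ha hab hb hθ' hK' hh' => ?_⟩
  · have l1 := hA s t h0 (h1.trans h2) h3
    have l2 := ((hA s u h0 h1 (h2.trans h3)).add (hA u t (h0.trans h1) h2 h3)).add_const (h s u t)
    refine tendsto_nhds_unique l1 (l2.congr fun F => ?_)
    exact (hid F s u t h0 h1 h2 h3).symm
  · refine le_of_tendsto (hA a b ha hab hb).abs ?_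
    filter_upwards [hmem a, hmem b] with F haF hbF
    exact hbd a b K' θ' ha hab hb hθ' hK' hh' F haF hbF

/-- The sewing lemma for continuous cocycles. -/
theorem sewing {T : ℝ} (hT : 0 ≤ T) {ω : ℝ → ℝ → ℝ} {h : ℝ → ℝ → ℝ → ℝ} (hω : IsControl T ω)
    (hcoc : ∀ s u v t, 0 ≤ s → s ≤ u → u ≤ v → v ≤ t → t ≤ T →
      h s u v + h s v t = h s u t + h u v t)
    {K θ : ℝ} (hθ : 1 < θ) (hK : 0 ≤ K)
    (hh : ∀ s u t, 0 ≤ s → s ≤ u → u ≤ t → t ≤ T → |h s u t| ≤ K * ω s t ^ θ)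
    (hc : ContinuousOn (fun x : ℝ × ℝ × ℝ => h x.1 x.2.1 x.2.2) (simplex₃ T)) :
    ∃ A : ℝ → ℝ → ℝ,
      (∀ s u t, 0 ≤ s → s ≤ u → u ≤ t → t ≤ T → A s t = A s u + A u t + h s u t) ∧
      (∃ C, 0 ≤ C ∧ ∀ s t, 0 ≤ s → s ≤ t → t ≤ T → |A s t| ≤ C * ω s t ^ θ) ∧
      ContinuousOn (fun x : ℝ × ℝ => A x.1 x.2) (simplex T) := by
  obtain ⟨A, hA, hAb⟩ := exists_sewing hω hcoc hθ hK hh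
  have hbound : ∀ s t, 0 ≤ s → s ≤ t → t ≤ T → |A s t| ≤ sewConst θ * K * ω s t ^ θ :=
    fun s t h0 h1 h2 => hAb s t K θ h0 h1 h2 hθ hK
      fun s' u' t' h0' h1' h2' h3' => hh _ _ _ (h0.trans h0') h1' h2' (h3'.trans h2)
  have hdiag : ∀ s, 0 ≤ s → s ≤ T → h s s s = 0 := by
    intro s h0 h1
    have e2 := hh s s s h0 le_rfl le_rfl h1
    rw [hω.self_eq_zero h0 h1, Real.zero_rpow (by linarith), mul_zero] at e2
    exact abs_eq_zero.1 (le_antisymm e2 (abs_nonneg _))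
  have hsmall : ∀ ε > 0, ∃ δ > 0, ∀ s u t, 0 ≤ s → s ≤ u → u ≤ t → t ≤ T → t - s < δ →
      |h s u t| ≤ ε := by
    intro ε hε
    have hu := (isCompact_simplex₃ T).uniformContinuousOn_of_continuous hc
    rw [Metric.uniformContinuousOn_iff] at hu
    obtain ⟨δ, hδ, H⟩ := hu ε hε
    refine ⟨δ, hδ, fun s u t hs hsu hut ht hlt => ?_⟩
    have := H (s, u, t) ⟨hs, hsu, hut, ht⟩ (s, s, s)
      ⟨hs, le_rfl, le_rfl, hsu.trans (hut.trans ht)⟩ (by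
        simp only [Prod.dist_eq, dist_self, Real.dist_eq]
        rw [abs_of_nonneg (by linarith), abs_of_nonneg (by linarith)]
        simp only [max_lt_iff]
        exact ⟨hδ, by linarith, hlt⟩)
    simp only [hdiag s hs (hsu.trans (hut.trans ht)), Real.dist_eq, sub_zero] at this
    exact this.le
  have hAsmall : SmallDiag T A := by
    intro ε hε
    -- The midpoint leaves room on both sides: `1 < θ'` for the local sewing bound, `θ' < θ` for
    -- interpolating the smallness of `h`.
    set θ' := (1 + θ) / 2 with hθ'
    have h1 : 1 < θ' := by rw [hθ']; linarith
    have h2 : θ' < θ := by rw [hθ']; linarith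
    have hM := hω.nonneg 0 T le_rfl hT le_rfl
    have hC := sewConst_pos h1
    set M := ω 0 T ^ θ'
    have hM0 : 0 ≤ M := Real.rpow_nonneg hM _
    set η := ε / (sewConst θ' * (M + 1)) with hη
    have hη0 : 0 < η := by positivity
    obtain ⟨ε', hε', H⟩ := exists_small_rpow hK (by linarith) h2 hη0
    obtain ⟨δ, hδ, H'⟩ := hsmall ε' hε'
    refine ⟨δ, hδ, fun s t hs hst ht hlt => ?_⟩
    have := hAb s t η θ' hs hst ht h1 hη0.le fun s' u' t' h0' h1' h2' h3' =>
      H _ _ (hω.nonneg s' t' (hs.trans h0') (h1'.trans h2') (h3'.trans ht))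
        (hh _ _ _ (hs.trans h0') h1' h2' (h3'.trans ht))
        (H' _ _ _ (hs.trans h0') h1' h2' (h3'.trans ht) (by linarith))
    refine this.trans ?_
    have hw : ω s t ^ θ' ≤ M + 1 := by
      have : ω s t ^ θ' ≤ M := Real.rpow_le_rpow (hω.nonneg s t hs hst ht)
        (hω.mono le_rfl hs hst ht le_rfl) (by linarith)
      linarith
    calc sewConst θ' * η * ω s t ^ θ' ≤ sewConst θ' * η * (M + 1) := by gcongr
      _ = ε := by rw [hη]; field_simp
  have hh0 : ContinuousOn (fun x : ℝ × ℝ => h 0 x.1 x.2) (simplex T) :=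
    hc.comp (f := fun x : ℝ × ℝ => ((0 : ℝ), x.1, x.2)) (by fun_prop)
      fun x hx => ⟨le_rfl, hx.1, hx.2.1, hx.2.2⟩
  have hh0small : SmallDiag T (fun s t => h 0 s t) := by
    refine SmallDiag.of_continuousOn hh0 fun s h0 h1 => ?_
    have := hcoc 0 s s s le_rfl h0 le_rfl le_rfl h1
    rw [hdiag s h0 h1] at this
    linarith
  -- Since `A s t = A 0 t - A 0 s - h 0 s t`, joint continuity reduces to continuity of the path `t
  -- ↦ A 0 t`.
  have hpath : ContinuousOn (fun t => A 0 t) (Set.Icc 0 T) := by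
    rw [Metric.continuousOn_iff]
    have key : ∀ ε > 0, ∃ δ > 0, ∀ s t, 0 ≤ s → s ≤ t → t ≤ T → t - s < δ →
        |A 0 t - A 0 s| < ε := by
      intro ε hε
      obtain ⟨δ₁, hδ₁, H₁⟩ := hAsmall (ε / 3) (by positivity)
      obtain ⟨δ₂, hδ₂, H₂⟩ := hh0small (ε / 3) (by positivity)
      refine ⟨min δ₁ δ₂, lt_min hδ₁ hδ₂, fun s t h0 h1 h2 h3 => ?_⟩
      have e1 := H₁ s t h0 h1 h2 (h3.trans_le (min_le_left _ _))
      have e2 := H₂ s t h0 h1 h2 (h3.trans_le (min_le_right _ _))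
      have e3 : A 0 t - A 0 s = A s t + h 0 s t := by rw [hA 0 s t le_rfl h0 h1 h2]; ring
      rw [e3]
      have := abs_add_le (A s t) (h 0 s t)
      linarith
    intro b hb ε hε
    obtain ⟨δ, hδ, H⟩ := key ε hε
    refine ⟨δ, hδ, fun a ha hab => ?_⟩
    rw [Real.dist_eq] at hab ⊢
    rcases le_total a b with h | h
    · rw [abs_sub_comm] at hab ⊢
      exact H a b ha.1 h hb.2 ((le_abs_self _).trans_lt hab)
    · exact H b a hb.1 h ha.2 ((le_abs_self _).trans_lt hab)
  refine ⟨A, hA, ⟨_, mul_nonneg (sewConst_pos hθ).le hK, hbound⟩, ?_⟩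
  have : ContinuousOn (fun x : ℝ × ℝ => A 0 x.2 - A 0 x.1 - h 0 x.1 x.2) (simplex T) := by
    refine ((hpath.comp continuous_snd.continuousOn ?_).sub
      (hpath.comp continuous_fst.continuousOn ?_)).sub hh0
    · exact fun x hx => ⟨hx.1.trans hx.2.1, hx.2.2⟩
    · exact fun x hx => ⟨hx.1, hx.2.1.trans hx.2.2⟩
  refine this.congr fun x hx => ?_
  simp only
  rw [hA 0 x.1 x.2 le_rfl hx.1 hx.2.1 hx.2.2]
  ring

/-! ### Controls and finite variation -/

/-- The sum of `f` over the intervals of a partition. -/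
def Partition.sum {s t : ℝ} (P : Partition s t) (f : ℝ → ℝ → ℝ) : ℝ :=
  ∑ i : Fin P.n, f (P.pt i.castSucc) (P.pt i.succ)

theorem Partition.exists_cons (f : ℝ → ℝ → ℝ) {s u t : ℝ} (hsu : s < u) (P : Partition u t) :
    ∃ R : Partition s t, R.sum f = f s u + P.sum f := by
  refine ⟨⟨P.n + 1, Fin.cons s P.pt, ?_, by simp, ?_⟩, ?_⟩
  · rw [Fin.strictMono_iff_lt_succ]
    intro i
    refine Fin.cases ?_ (fun j => ?_) i
    · simpa [P.first] using hsu
    · simpa using P.strictMono j.castSucc_lt_succ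
  · rw [← Fin.succ_last, Fin.cons_succ, P.last]
  · simp only [Partition.sum]
    rw [Fin.sum_univ_succ]
    simp [P.first]

theorem Partition.exists_nil (f : ℝ → ℝ → ℝ) (s : ℝ) : ∃ R : Partition s s, R.sum f = 0 :=
  ⟨⟨0, fun _ => s, fun i j h => absurd h (by omega), rfl, rfl⟩, by simp [Partition.sum]⟩

theorem Partition.exists_single (f : ℝ → ℝ → ℝ) {s t : ℝ} (hst : s < t) :
    ∃ R : Partition s t, R.sum f = f s t := by
  obtain ⟨P, hP⟩ := Partition.exists_nil f t
  obtain ⟨R, hR⟩ := Partition.exists_cons f hst P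
  exact ⟨R, by rw [hR, hP, add_zero]⟩

theorem Partition.nonempty {s t : ℝ} (hst : s ≤ t) : Nonempty (Partition s t) := by
  rcases hst.eq_or_lt with rfl | h
  · exact ⟨(Partition.exists_nil 0 s).choose⟩
  · exact ⟨(Partition.exists_single 0 h).choose⟩

/-- Only the value of the sum is recorded, and the first interval is peeled off recursively; this
avoids index arithmetic for a concatenated point sequence. -/
theorem Partition.exists_append (f : ℝ → ℝ → ℝ) {u t : ℝ} (R : Partition u t) :
    ∀ (n : ℕ) (s : ℝ) (P : Partition s u), P.n = n →
      ∃ Q : Partition s t, Q.sum f = P.sum f + R.sum f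
  | 0, s, ⟨m, pt, hmono, hfirst, hlast⟩, hn => by
    simp only at hn
    subst hn
    have hs : s = u := by rw [← hfirst, ← hlast]; rfl
    subst hs
    exact ⟨R, by simp [Partition.sum]⟩
  | n + 1, s, ⟨m, pt, hmono, hfirst, hlast⟩, hn => by
    simp only at hn
    subst hn
    obtain ⟨Q, hQ⟩ := Partition.exists_append f R n (pt 1)
      ⟨n, fun i => pt i.succ, hmono.comp (Fin.strictMono_succ), rfl, hlast⟩ rfl
    obtain ⟨Q', hQ'⟩ := Partition.exists_cons f
      (show s < pt 1 by rw [← hfirst]; exact hmono Fin.zero_lt_one) Q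
    refine ⟨Q', ?_⟩
    rw [hQ', hQ]
    simp only [Partition.sum]
    rw [Fin.sum_univ_succ (n := n)]
    simp [hfirst, add_assoc]

/-- A nonnegative two-parameter function with bounded sums over partitions is controlled. -/
theorem exists_control {T : ℝ} {f : ℝ → ℝ → ℝ} (hf : ∀ s t, 0 ≤ f s t) {B : ℝ}
    (hB : ∀ P : Partition 0 T, P.sum f ≤ B) :
    ∃ ω, IsControl T ω ∧ ∀ s t, 0 ≤ s → s < t → t ≤ T → f s t ≤ ω s t := by
  have hnn : ∀ {s t} (P : Partition s t), 0 ≤ P.sum f := fun P =>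
    Finset.sum_nonneg fun i _ => hf _ _
  have hbdd : ∀ s t, 0 ≤ s → t ≤ T → BddAbove (Set.range fun P : Partition s t => P.sum f) := by
    intro s t h0 h1
    refine ⟨B, ?_⟩
    rintro _ ⟨P, rfl⟩
    -- A partition of `[s, t]` is padded to one of `[0, T]`; nonnegativity of `f` lets the padding
    -- be discarded.
    obtain ⟨P₀⟩ := Partition.nonempty h0
    obtain ⟨P₁⟩ := Partition.nonempty h1
    obtain ⟨Q, hQ⟩ := Partition.exists_append f P₁ _ s P rfl
    obtain ⟨Q', hQ'⟩ := Partition.exists_append f Q _ 0 P₀ rfl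
    have := hB Q'
    have := hnn P₀
    have := hnn P₁
    simp only
    linarith
  refine ⟨fun s t => ⨆ P : Partition s t, P.sum f, ⟨fun s t _ _ _ => ?_, ?_⟩, ?_⟩
  · exact Real.iSup_nonneg fun P => hnn P
  · intro s u t h0 h1 h2 h3
    have := Partition.nonempty h1
    have := Partition.nonempty h2
    refine ciSup_add_ciSup_le fun P R => ?_
    obtain ⟨Q, hQ⟩ := Partition.exists_append f R _ s P rfl
    rw [← hQ]
    exact le_ciSup (hbdd s t h0 h3) Q
  · intro s t h0 h1 h2
    obtain ⟨Q, hQ⟩ := Partition.exists_single f h1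
    rw [← hQ]
    exact le_ciSup (hbdd s t h0 h2) Q

theorem sum_enorm_rpow {E : Type*} [NormedAddCommGroup E] {r : ℝ} (hr : 0 ≤ r) (A : ℝ → ℝ → E)
    {s t : ℝ} (P : Partition s t) :
    ∑ i : Fin P.n, ‖A (P.pt i.castSucc) (P.pt i.succ)‖ₑ ^ r
      = ENNReal.ofReal (P.sum fun s t => ‖A s t‖ ^ r) := by
  rw [Partition.sum, ENNReal.ofReal_sum_of_nonneg fun i _ => by positivity]
  refine Finset.sum_congr rfl fun i _ => ?_
  rw [← ofReal_norm, ENNReal.ofReal_rpow_of_nonneg (norm_nonneg _) hr]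

/-- The control is the supremum of `‖A‖ ^ r`-sums over partitions. The bound needs `s < t`: the only
partition of `[s, s]` has an empty sum and says nothing about `A s s`. -/
theorem exists_control_of_variation {E : Type*} [NormedAddCommGroup E] {r T : ℝ} (hr : 0 < r)
    {A : ℝ → ℝ → E} (hA : variation r A 0 T < ⊤) :
    ∃ ω, IsControl T ω ∧ ∀ s t, 0 ≤ s → s < t → t ≤ T → ‖A s t‖ ≤ ω s t ^ (1 / r) := by
  rw [variation, ENNReal.rpow_lt_top_iff_of_pos (by positivity)] at hA
  obtain ⟨ω, hω, h⟩ := exists_control (T := T) (f := fun s t => ‖A s t‖ ^ r)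
    (fun s t => by positivity)
    (B := (⨆ P : Partition 0 T,
      ∑ i : Fin P.n, ‖A (P.pt i.castSucc) (P.pt i.succ)‖ₑ ^ r).toReal) (by
      intro P
      rw [← ENNReal.ofReal_le_iff_le_toReal hA.ne, ← sum_enorm_rpow hr.le]
      exact le_iSup (fun P : Partition 0 T =>
        ∑ i : Fin P.n, ‖A (P.pt i.castSucc) (P.pt i.succ)‖ₑ ^ r) P)
  refine ⟨ω, hω, fun s t h0 h1 h2 => ?_⟩
  have := Real.rpow_le_rpow (by positivity) (h s t h0 h1 h2) (z := 1 / r) (by positivity)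
  rwa [← Real.rpow_mul (norm_nonneg _), mul_one_div_cancel hr.ne', Real.rpow_one] at this

theorem variation_lt_top_of_le {E : Type*} [NormedAddCommGroup E] {r T C : ℝ} (hr : 0 < r)
    {A : ℝ → ℝ → E} {ω : ℝ → ℝ → ℝ} (hω : IsControl T ω) (hC : 0 ≤ C)
    (hA : ∀ s t, 0 ≤ s → s ≤ t → t ≤ T → ‖A s t‖ ≤ C * ω s t ^ (1 / r)) :
    variation r A 0 T < ⊤ := by
  rw [variation, ENNReal.rpow_lt_top_iff_of_pos (by positivity)]
  refine lt_of_le_of_lt (iSup_le fun P => ?_) (ENNReal.ofReal_lt_top (r := C ^ r * ω 0 T))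
  rw [sum_enorm_rpow hr.le]
  refine ENNReal.ofReal_le_ofReal ?_
  calc P.sum (fun s t => ‖A s t‖ ^ r)
      ≤ ∑ i : Fin P.n, C ^ r * ω (P.pt i.castSucc) (P.pt i.succ) := by
        refine Finset.sum_le_sum fun i _ => ?_
        have h0 := (P.mem_Icc i.castSucc).1
        have h1 := P.strictMono.monotone i.castSucc_lt_succ.le
        have h2 := (P.mem_Icc i.succ).2
        have h3 := hω.nonneg _ _ h0 h1 h2
        have := Real.rpow_le_rpow (norm_nonneg _) (hA _ _ h0 h1 h2) hr.le
        rwa [Real.mul_rpow hC (by positivity), ← Real.rpow_mul h3, one_div_mul_cancel hr.ne',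
          Real.rpow_one] at this
    _ = C ^ r * ∑ i : Fin P.n, ω (P.pt i.castSucc) (P.pt i.succ) := by rw [Finset.mul_sum]
    _ ≤ C ^ r * ω 0 T := by
      gcongr
      exact hω.sum_partition_le le_rfl le_rfl P

/-! ### Tensor series -/

namespace TSeries

variable {ι : Type*}

theorem tensor_nil (a b : TSeries ι) : a.tensor b [] = a [] * b [] := by
  simp [tensor]

theorem tensor_cons (a b : TSeries ι) (i : ι) (w : List ι) :
    a.tensor b (i :: w) = a [] * b (i :: w) + tensor (fun v => a (i :: v)) b w := by
  simp only [tensor, List.length_cons]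
  rw [Finset.sum_range_succ', add_comm]
  simp

theorem tensor_lin_left (c : ℝ) (a a' b : TSeries ι) (w : List ι) :
    tensor (fun v => c * a v + a' v) b w = c * a.tensor b w + a'.tensor b w := by
  simp only [tensor, Finset.mul_sum, ← Finset.sum_add_distrib]
  exact Finset.sum_congr rfl fun k _ => by ring

theorem tensor_assoc (c b : TSeries ι) : ∀ (w : List ι) (a : TSeries ι),
    (a.tensor b).tensor c w = a.tensor (b.tensor c) w
  | [], a => by simp only [tensor_nil]; ring
  | i :: w, a => by
    have h : (fun v => a.tensor b (i :: v))
        = fun v => a [] * (fun v => b (i :: v)) v + tensor (fun v => a (i :: v)) b v := by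
      funext v
      rw [tensor_cons]
    rw [tensor_cons, h, tensor_lin_left, tensor_assoc c b w, tensor_cons a, tensor_nil,
      tensor_cons b]
    ring

/-- The part of the product coming from splittings of a word into two proper pieces. -/
def mid (a b : TSeries ι) (w : List ι) : ℝ :=
  ∑ k ∈ Finset.Ico 1 w.length, a (w.take k) * b (w.drop k)

theorem tensor_eq_mid (a b : TSeries ι) {w : List ι} (hw : w ≠ []) :
    a.tensor b w = a [] * b w + a.mid b w + a w * b [] := by
  have hl : 1 ≤ w.length := List.length_pos_iff.2 hw
  rw [tensor, mid, Finset.sum_range_succ, Finset.range_eq_Ico,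
    Finset.sum_eq_sum_Ico_succ_bot (by omega)]
  simp

/-- Associativity of `⊗` with the trivial splittings cancelled. This is the cocycle identity that
sewing requires when a new word is added. -/
theorem mid_assoc {a b c : TSeries ι} (ha : a [] = 1) (hb : b [] = 1) (hc : c [] = 1) {w : List ι}
    (hw : w ≠ []) :
    a.mid b w + (a.tensor b).mid c w = a.mid (b.tensor c) w + b.mid c w := by
  have h := tensor_assoc c b w a
  rw [tensor_eq_mid _ c hw, tensor_eq_mid a (b.tensor c) hw, tensor_eq_mid a b hw, tensor_eq_mid b c hw,
    tensor_nil, tensor_nil, ha, hb, hc] at h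
  linarith

end TSeries

/-! ### Extension of weighted multiplicative functionals -/

/-- `A` is bounded by a constant times `ω ^ (n / p)` on the simplex. -/
def HomBound (p T : ℝ) (ω : ℝ → ℝ → ℝ) (n : ℕ) (A : ℝ → ℝ → ℝ) : Prop :=
  ∃ C, 0 ≤ C ∧ ∀ s t, 0 ≤ s → s ≤ t → t ≤ T → |A s t| ≤ C * ω s t ^ ((n : ℝ) / p)

namespace HomBound

variable {p T : ℝ} {ω : ℝ → ℝ → ℝ} {n m : ℕ} {A B : ℝ → ℝ → ℝ}

theorem congr (hA : HomBound p T ω n A)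
    (h : ∀ s t, 0 ≤ s → s ≤ t → t ≤ T → B s t = A s t) : HomBound p T ω n B := by
  obtain ⟨C, hC, hb⟩ := hA
  exact ⟨C, hC, fun s t h0 h1 h2 => by rw [h s t h0 h1 h2]; exact hb s t h0 h1 h2⟩

theorem zero (p T : ℝ) (ω : ℝ → ℝ → ℝ) (n : ℕ) : HomBound p T ω n (fun _ _ => 0) :=
  ⟨0, le_rfl, fun s t _ _ _ => by simp⟩

theorem add (hA : HomBound p T ω n A) (hB : HomBound p T ω n B) :
    HomBound p T ω n (fun s t => A s t + B s t) := by
  obtain ⟨C, hC, h⟩ := hA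
  obtain ⟨C', hC', h'⟩ := hB
  refine ⟨C + C', add_nonneg hC hC', fun s t h0 h1 h2 => (abs_add_le _ _).trans ?_⟩
  rw [add_mul]
  exact add_le_add (h s t h0 h1 h2) (h' s t h0 h1 h2)

theorem neg (hA : HomBound p T ω n A) : HomBound p T ω n (fun s t => -A s t) := by
  obtain ⟨C, hC, h⟩ := hA
  exact ⟨C, hC, fun s t h0 h1 h2 => by rw [abs_neg]; exact h s t h0 h1 h2⟩

theorem sub (hA : HomBound p T ω n A) (hB : HomBound p T ω n B) :
    HomBound p T ω n (fun s t => A s t - B s t) := by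
  simpa only [sub_eq_add_neg] using hA.add hB.neg

theorem mul (hω : IsControl T ω) (hp : 0 < p) (hA : HomBound p T ω n A)
    (hB : HomBound p T ω m B) : HomBound p T ω (n + m) (fun s t => A s t * B s t) := by
  obtain ⟨C, hC, h⟩ := hA
  obtain ⟨C', hC', h'⟩ := hB
  refine ⟨C * C', mul_nonneg hC hC', fun s t h0 h1 h2 => ?_⟩
  have hw := hω.nonneg s t h0 h1 h2
  rw [abs_mul, Nat.cast_add, add_div, Real.rpow_add_of_nonneg hw (by positivity) (by positivity)]
  calc |A s t| * |B s t| ≤ (C * ω s t ^ ((n : ℝ) / p)) * (C' * ω s t ^ ((m : ℝ) / p)) :=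
        mul_le_mul (h s t h0 h1 h2) (h' s t h0 h1 h2) (abs_nonneg _) (by positivity)
    _ = _ := by ring

theorem mono (hω : IsControl T ω) (hT : 0 ≤ T) (hp : 0 < p) (hnm : n ≤ m)
    (hA : HomBound p T ω m A) : HomBound p T ω n A := by
  obtain ⟨C, hC, h⟩ := hA
  obtain ⟨C', hC', h'⟩ := hω.rpow_le hT (x := (n : ℝ) / p) (y := (m : ℝ) / p) (by positivity)
    (by gcongr)
  refine ⟨C * C', mul_nonneg hC hC', fun s t h0 h1 h2 => (h s t h0 h1 h2).trans ?_⟩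
  rw [mul_assoc]
  exact mul_le_mul_of_nonneg_left (h' s t h0 h1 h2) hC

theorem self_eq_zero (hω : IsControl T ω) (hp : 0 < p) (hn : 0 < n) (hA : HomBound p T ω n A)
    {s : ℝ} (h0 : 0 ≤ s) (h1 : s ≤ T) : A s s = 0 := by
  obtain ⟨C, hC, h⟩ := hA
  have := h s s h0 le_rfl h1
  have hne : (n : ℝ) / p ≠ 0 := by positivity
  rw [hω.self_eq_zero h0 h1, Real.zero_rpow hne, mul_zero] at this
  exact abs_eq_zero.1 (le_antisymm this (abs_nonneg _))

end HomBound

section Weighted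

variable {ι : Type*}

/-- The weight of a word. -/
def weight (wt : ι → ℕ) (w : List ι) : ℕ := (w.map wt).sum

theorem weight_nil (wt : ι → ℕ) : weight wt [] = 0 := rfl

theorem weight_cons (wt : ι → ℕ) (i : ι) (w : List ι) :
    weight wt (i :: w) = wt i + weight wt w := by simp [weight]

theorem weight_append (wt : ι → ℕ) (v w : List ι) :
    weight wt (v ++ w) = weight wt v + weight wt w := by simp [weight]

theorem weight_take_add_drop (wt : ι → ℕ) (w : List ι) (k : ℕ) :
    weight wt (w.take k) + weight wt (w.drop k) = weight wt w := by
  rw [← weight_append, List.take_append_drop]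

theorem length_le_weight {wt : ι → ℕ} (hwt : ∀ i, 1 ≤ wt i) : ∀ w : List ι, w.length ≤ weight wt w
  | [] => by simp [weight]
  | i :: w => by
    have := length_le_weight hwt w
    have := hwt i
    rw [weight_cons, List.length_cons]
    omega

theorem weight_take_lt {wt : ι → ℕ} (hwt : ∀ i, 1 ≤ wt i) {w : List ι} {k : ℕ}
    (hk : k ∈ Finset.Ico 1 w.length) :
    weight wt (w.take k) < weight wt w ∧ weight wt (w.drop k) < weight wt w := by
  have h := weight_take_add_drop wt w k
  have h1 := length_le_weight hwt (w.take k)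
  have h2 := length_le_weight hwt (w.drop k)
  simp only [Finset.mem_Ico] at hk
  simp only [List.length_take, List.length_drop] at h1 h2
  omega

/-- A continuous multiplicative functional with the homogeneity given by `wt`, on words of weight
at most `n`. -/
structure IsWeightedFunctional (wt : ι → ℕ) (p T : ℝ) (ω : ℝ → ℝ → ℝ) (n : ℕ)
    (S : ℝ → ℝ → TSeries ι) : Prop where
  nil : ∀ s t, 0 ≤ s → s ≤ t → t ≤ T → S s t [] = 1
  chen : ∀ w, weight wt w ≤ n → ∀ s u t, 0 ≤ s → s ≤ u → u ≤ t → t ≤ T →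
    (S s u).tensor (S u t) w = S s t w
  bound : ∀ w, weight wt w ≤ n → HomBound p T ω (weight wt w) (fun s t => S s t w)
  cont : ∀ w, weight wt w ≤ n → ContinuousOn (fun x : ℝ × ℝ => S x.1 x.2 w) (simplex T)

theorem IsWeightedFunctional.congr {wt : ι → ℕ} {p T : ℝ} {ω : ℝ → ℝ → ℝ} {n : ℕ}
    {S S' : ℝ → ℝ → TSeries ι} (hS : IsWeightedFunctional wt p T ω n S)
    (h : ∀ s t w, weight wt w ≤ n → S' s t w = S s t w) :
    IsWeightedFunctional wt p T ω n S' where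
  nil s t h0 h1 h2 := by rw [h s t [] (Nat.zero_le _)]; exact hS.nil s t h0 h1 h2
  chen w hw s u t h0 h1 h2 h3 := by
    rw [h s t w hw, ← hS.chen w hw s u t h0 h1 h2 h3]
    refine Finset.sum_congr rfl fun k _ => ?_
    have := weight_take_add_drop wt w k
    rw [h _ _ _ (by omega), h _ _ _ (by omega)]
  bound w hw := (hS.bound w hw).congr fun s t _ _ _ => h s t w hw
  cont w hw := (hS.cont w hw).congr fun x _ => h x.1 x.2 w hw

/-- Sewing of the next component of a multiplicative functional. -/
theorem IsWeightedFunctional.exists_component {wt : ι → ℕ} (hwt : ∀ i, 1 ≤ wt i) {p T : ℝ}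
    (hp : 0 < p) (hT : 0 ≤ T) {ω : ℝ → ℝ → ℝ} (hω : IsControl T ω) {n : ℕ} (hn : p < n + 1)
    {S : ℝ → ℝ → TSeries ι} (hS : IsWeightedFunctional wt p T ω n S) (w : List ι)
    (hw : weight wt w = n + 1) :
    ∃ A : ℝ → ℝ → ℝ,
      (∀ s u t, 0 ≤ s → s ≤ u → u ≤ t → t ≤ T →
        A s t = A s u + A u t + (S s u).mid (S u t) w) ∧
      HomBound p T ω (n + 1) A ∧
      ContinuousOn (fun x : ℝ × ℝ => A x.1 x.2) (simplex T) := by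
  have hwne : w ≠ [] := by rintro rfl; simp [weight] at hw
  have hlt : ∀ k ∈ Finset.Ico 1 w.length,
      weight wt (w.take k) ≤ n ∧ weight wt (w.drop k) ≤ n := fun k hk => by
    have := weight_take_lt hwt hk
    omega
  have hpiece : ∀ k ∈ Finset.Ico 1 w.length, ∃ C, 0 ≤ C ∧ ∀ s u t, 0 ≤ s → s ≤ u → u ≤ t →
      t ≤ T → |S s u (w.take k) * S u t (w.drop k)| ≤ C * ω s t ^ (((n + 1 : ℕ) : ℝ) / p) := by
    intro k hk
    obtain ⟨C, hC, hb⟩ := hS.bound _ (hlt k hk).1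
    obtain ⟨C', hC', hb'⟩ := hS.bound _ (hlt k hk).2
    refine ⟨C * C', mul_nonneg hC hC', fun s u t h0 h1 h2 h3 => ?_⟩
    have e1 := hω.nonneg s u h0 h1 (h2.trans h3)
    have e2 := hω.nonneg u t (h0.trans h1) h2 h3
    have e3 := hω.nonneg s t h0 (h1.trans h2) h3
    have e4 := hω.mono h0 le_rfl h1 h2 h3
    have e5 := hω.mono h0 h1 h2 le_rfl h3
    rw [abs_mul, ← hw, ← weight_take_add_drop wt w k, Nat.cast_add, add_div,
      Real.rpow_add_of_nonneg e3 (by positivity) (by positivity)]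
    calc |S s u (w.take k)| * |S u t (w.drop k)|
        ≤ (C * ω s u ^ ((weight wt (w.take k) : ℝ) / p))
          * (C' * ω u t ^ ((weight wt (w.drop k) : ℝ) / p)) :=
          mul_le_mul (hb s u h0 h1 (h2.trans h3)) (hb' u t (h0.trans h1) h2 h3) (abs_nonneg _)
            (by positivity)
      _ ≤ (C * ω s t ^ ((weight wt (w.take k) : ℝ) / p))
          * (C' * ω s t ^ ((weight wt (w.drop k) : ℝ) / p)) := by gcongr
      _ = _ := by ring
  choose! C hC hCb using hpiece
  have hθ : 1 < ((n + 1 : ℕ) : ℝ) / p := by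
    rw [one_lt_div hp]
    push_cast
    exact hn
  -- The proper splittings involve only words of smaller weight, hence already constructed
  -- coefficients; the weights of the two pieces add up to `n + 1`, which gives the exponent.
  refine sewing hT hω (h := fun s u t => (S s u).mid (S u t) w)
    (K := ∑ k ∈ Finset.Ico 1 w.length, C k) (θ := ((n + 1 : ℕ) : ℝ) / p) ?_ hθ
    (Finset.sum_nonneg fun k hk => hC k hk) ?_ ?_
  · intro s u v t h0 h1 h2 h3 h4
    have e := TSeries.mid_assoc (hS.nil s u h0 h1 (h2.trans (h3.trans h4)))
      (hS.nil u v (h0.trans h1) h2 (h3.trans h4)) (hS.nil v t (h0.trans (h1.trans h2)) h3 h4) hwne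
    have e1 : ((S s u).tensor (S u v)).mid (S v t) w = (S s v).mid (S v t) w :=
      Finset.sum_congr rfl fun k hk => by
        rw [hS.chen _ (hlt k hk).1 s u v h0 h1 h2 (h3.trans h4)]
    have e2 : (S s u).mid ((S u v).tensor (S v t)) w = (S s u).mid (S u t) w :=
      Finset.sum_congr rfl fun k hk => by
        rw [hS.chen _ (hlt k hk).2 u v t (h0.trans h1) h2 h3 h4]
    rw [e1, e2] at e
    exact e
  · intro s u t h0 h1 h2 h3
    rw [Finset.sum_mul]
    exact (Finset.abs_sum_le_sum_abs _ _).trans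
      (Finset.sum_le_sum fun k hk => hCb k hk s u t h0 h1 h2 h3)
  · refine continuousOn_finsetSum _ fun k hk => ContinuousOn.mul ?_ ?_
    · exact (hS.cont _ (hlt k hk).1).comp (f := fun x : ℝ × ℝ × ℝ => (x.1, x.2.1)) (by fun_prop)
        fun x hx => ⟨hx.1, hx.2.1, hx.2.2.1.trans hx.2.2.2⟩
    · exact (hS.cont _ (hlt k hk).2).comp (f := fun x : ℝ × ℝ × ℝ => (x.2.1, x.2.2)) (by fun_prop)
        fun x hx => ⟨hx.1.trans hx.2.1, hx.2.2.1, hx.2.2.2⟩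

/-- Words of weight exactly `n + 1` can be sewn independently of each other: all letters have
positive weight, so their proper pieces have weight at most `n`. -/
theorem IsWeightedFunctional.exists_succ {wt : ι → ℕ} (hwt : ∀ i, 1 ≤ wt i) {p T : ℝ}
    (hp : 0 < p) (hT : 0 ≤ T) {ω : ℝ → ℝ → ℝ} (hω : IsControl T ω) {n : ℕ} (hn : p < n + 1)
    {S : ℝ → ℝ → TSeries ι} (hS : IsWeightedFunctional wt p T ω n S) :
    ∃ S', IsWeightedFunctional wt p T ω (n + 1) S' ∧
      ∀ s t w, weight wt w ≤ n → S' s t w = S s t w := by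
  classical
  choose! A hA1 hA2 hA3 using hS.exists_component hwt hp hT hω hn
  set S' : ℝ → ℝ → TSeries ι := fun s t w =>
    if weight wt w = n + 1 then A w s t else S s t w with hS'
  have hlow : ∀ s t w, weight wt w ≤ n → S' s t w = S s t w := fun s t w hw => by
    simp only [hS']
    rw [if_neg (by omega)]
  have hhigh : ∀ s t w, weight wt w = n + 1 → S' s t w = A w s t := fun s t w hw => by
    simp only [hS']
    rw [if_pos hw]
  have hlow' := hS.congr hlow
  refine ⟨S', ⟨hlow'.nil, fun w hw s u t h0 h1 h2 h3 => ?_, fun w hw => ?_, fun w hw => ?_⟩, hlow⟩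
  all_goals rcases Nat.le_succ_iff.1 hw with hw' | hw'
  · exact hlow'.chen w hw' s u t h0 h1 h2 h3
  · have hwne : w ≠ [] := by rintro rfl; simp [weight] at hw'
    rw [TSeries.tensor_eq_mid _ _ hwne, hhigh _ _ w hw', hhigh _ _ w hw', hhigh _ _ w hw',
      hlow'.nil s u h0 h1 (h2.trans h3), hlow'.nil u t (h0.trans h1) h2 h3,
      hA1 w hw' s u t h0 h1 h2 h3]
    have : (S' s u).mid (S' u t) w = (S s u).mid (S u t) w :=
      Finset.sum_congr rfl fun k hk => by
        have := weight_take_lt hwt hk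
        rw [hlow _ _ _ (by omega), hlow _ _ _ (by omega)]
    rw [this]
    ring
  · exact hlow'.bound w hw'
  · rw [hw']
    exact (hA2 w hw').congr fun s t _ _ _ => hhigh s t w hw'
  · exact hlow'.cont w hw'
  · exact (hA3 w hw').congr fun x _ => hhigh x.1 x.2 w hw'

/-- Extension of a multiplicative functional to all words. -/
theorem IsWeightedFunctional.exists_extension {wt : ι → ℕ} (hwt : ∀ i, 1 ≤ wt i) {p T : ℝ}
    (hp : 0 < p) (hT : 0 ≤ T) {ω : ℝ → ℝ → ℝ} (hω : IsControl T ω) {N : ℕ} (hN : p < N + 1)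
    {S : ℝ → ℝ → TSeries ι} (hS : IsWeightedFunctional wt p T ω N S) :
    ∃ S', (∀ n, IsWeightedFunctional wt p T ω n S') ∧
      ∀ s t w, weight wt w ≤ N → S' s t w = S s t w := by
  have hstep : ∀ k (R : {R // IsWeightedFunctional wt p T ω (N + k) R}),
      ∃ R' : {R // IsWeightedFunctional wt p T ω (N + (k + 1)) R},
        ∀ s t w, weight wt w ≤ N + k → R'.1 s t w = R.1 s t w := by
    rintro k ⟨R, hR⟩
    obtain ⟨R', hR', h⟩ := hR.exists_succ hwt hp hT hω
      (by push_cast; linarith [k.cast_nonneg (α := ℝ)])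
    exact ⟨⟨R', hR'⟩, h⟩
  choose next hnext using hstep
  let f : ∀ k, {R // IsWeightedFunctional wt p T ω (N + k) R} := fun k =>
    Nat.rec ⟨S, hS⟩ (fun k R => next k R) k
  have hf : ∀ k j s t w, weight wt w ≤ N + k → (f (k + j)).1 s t w = (f k).1 s t w := by
    intro k j
    induction j with
    | zero => intros; rfl
    | succ j ih =>
      intro s t w hw
      rw [← ih s t w hw]
      exact hnext (k + j) (f (k + j)) s t w (by omega)
  -- Stage `k` is final on weights up to `N + k`, so the stage indexed by the weight of `w` can
  -- safely be read at `w`.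
  refine ⟨fun s t w => (f (weight wt w)).1 s t w, fun n => ?_, fun s t w hw => ?_⟩
  · have h := (f n).2
    have h' : IsWeightedFunctional wt p T ω n (f n).1 :=
      ⟨h.nil, fun w hw => h.chen w (by omega), fun w hw => h.bound w (by omega),
        fun w hw => h.cont w (by omega)⟩
    refine h'.congr fun s t w hw => ?_
    have := hf (weight wt w) (n - weight wt w) s t w (by omega)
    rw [Nat.add_sub_cancel' hw] at this
    exact this.symm
  · have := hf 0 (weight wt w) s t w (by omega)
    rw [Nat.zero_add] at this
    exact this

end Weighted

/-! ### The extended path -/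

theorem norm_le_sum_abs {κ : Type*} [Fintype κ] (x : EuclideanSpace ℝ κ) :
    ‖x‖ ≤ ∑ k, |x k| := by
  rw [EuclideanSpace.norm_eq]
  refine Real.sqrt_le_iff.2 ⟨Finset.sum_nonneg fun _ _ => abs_nonneg _, ?_⟩
  simp only [Real.norm_eq_abs]
  exact Finset.sum_sq_le_sq_sum_of_nonneg fun _ _ => abs_nonneg _

theorem abs_apply_le_norm {κ : Type*} [Fintype κ] (x : EuclideanSpace ℝ κ) (k : κ) :
    |x k| ≤ ‖x‖ := by
  rw [← Real.norm_eq_abs]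
  exact PiLp.norm_apply_le x k

/-- Finite `p / n`-variation from bounds on the coordinates. -/
theorem variation_lt_top_of_homBound {κ : Type*} [Fintype κ] {p T : ℝ} (hp : 0 < p)
    {ω : ℝ → ℝ → ℝ} (hω : IsControl T ω) {n : ℕ} (hn : 1 ≤ n)
    {A : ℝ → ℝ → EuclideanSpace ℝ κ} (hA : ∀ k, HomBound p T ω n (fun s t => A s t k)) :
    variation (p / n) A 0 T < ⊤ := by
  choose C hC hb using hA
  refine variation_lt_top_of_le (C := ∑ k, C k) (by positivity) hω
    (Finset.sum_nonneg fun k _ => hC k) fun s t h0 h1 h2 => ?_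
  rw [one_div_div, Finset.sum_mul]
  exact (norm_le_sum_abs _).trans (Finset.sum_le_sum fun k _ => hb k s t h0 h1 h2)

variable {d : ℕ}

/-- The homogeneity of the components of the extended path. -/
def extWeight : ExtIndex d → ℕ
  | .path _ => 1
  | _ => 2

theorem one_le_extWeight (a : ExtIndex d) : 1 ≤ extWeight a := by
  cases a <;> simp [extWeight]

/-- These words carry exactly the prescribed data. A pair containing time or a bracket has weight at
least 3 and is left to sewing. -/
theorem cases_of_weight_le_two {w : List (ExtIndex d)} (hw : weight extWeight w ≤ 2) :
    w = [] ∨ (∃ a, w = [a]) ∨ ∃ i j, w = [.path i, .path j] := by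
  match w with
  | [] => exact Or.inl rfl
  | [a] => exact Or.inr (Or.inl ⟨a, rfl⟩)
  | [a, b] =>
    refine Or.inr (Or.inr ?_)
    cases a <;> cases b <;> simp_all [weight, extWeight]
  | a :: b :: c :: v =>
    have := length_le_weight one_le_extWeight (a :: b :: c :: v)
    simp only [List.length_cons] at this
    omega

/-- The components of weight at most two of the signature of the extended path. -/
def extBase (X : ℝ → EuclideanSpace ℝ (Fin d)) (XX : ℝ → ℝ → EuclideanSpace ℝ (Fin d × Fin d))
    (s t : ℝ) : TSeries (ExtIndex d)
  | [] => 1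
  | [a] => extPath X XX t a - extPath X XX s a
  | [.path i, .path j] => XX s t (i, j)
  | _ => 0

section

variable {p T : ℝ} {X : ℝ → EuclideanSpace ℝ (Fin d)}
  {XX : ℝ → ℝ → EuclideanSpace ℝ (Fin d × Fin d)}

theorem IsRoughPath.self_eq_zero (hX : IsRoughPath p T X XX) {s : ℝ} (h0 : 0 ≤ s) (h1 : s ≤ T)
    (i j : Fin d) : XX s s (i, j) = 0 := by
  have := hX.chen s s s h0 le_rfl le_rfl h1 i j
  linarith

/-- The cross terms of the product are cancelled by Chen's relation for `(i, j)` and `(j, i)`. Hence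
bracket increments have homogeneity 2. -/
theorem IsRoughPath.bracket_sub (hX : IsRoughPath p T X XX) {s t : ℝ} (h0 : 0 ≤ s) (h1 : s ≤ t)
    (h2 : t ≤ T) (i j : Fin d) :
    bracket X XX t i j - bracket X XX s i j
      = (X t i - X s i) * (X t j - X s j) - (XX s t (i, j) + XX s t (j, i)) := by
  have e1 := hX.chen 0 s t le_rfl h0 h1 h2 i j
  have e2 := hX.chen 0 s t le_rfl h0 h1 h2 j i
  simp only [bracket]
  rw [e1, e2]
  ring

/-- A control for a rough path, dominating time as well. -/
theorem IsRoughPath.exists_control (hX : IsRoughPath p T X XX) (hp : 2 < p) :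
    ∃ ω, IsControl T ω ∧
      (∀ i, HomBound p T ω 1 (fun s t => X t i - X s i)) ∧
      (∀ i j, HomBound p T ω 2 (fun s t => XX s t (i, j))) ∧
      HomBound p T ω 2 (fun s t => t - s) := by
  obtain ⟨ω₁, hω₁, h₁⟩ := exists_control_of_variation (by linarith) hX.variation_fst
  obtain ⟨ω₂, hω₂, h₂⟩ := exists_control_of_variation (by linarith) hX.variation_snd
  have hω := (hω₁.add hω₂).add (IsControl.sub_time T)
  refine ⟨_, hω, fun i => ⟨1, zero_le_one, fun s t h0 h1 h2 => ?_⟩,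
    fun i j => ⟨1, zero_le_one, fun s t h0 h1 h2 => ?_⟩, ?_⟩
  · have e1 := hω₁.nonneg s t h0 h1 h2
    have e2 := hω₂.nonneg s t h0 h1 h2
    rw [one_mul, Nat.cast_one]
    rcases h1.eq_or_lt with rfl | hlt
    · simp only [sub_self, abs_zero]
      positivity
    · have e3 := (abs_apply_le_norm (X t - X s) i).trans (h₁ s t h0 hlt h2)
      refine e3.trans (Real.rpow_le_rpow e1 ?_ (by positivity))
      linarith
  · have e1 := hω₁.nonneg s t h0 h1 h2
    have e2 := hω₂.nonneg s t h0 h1 h2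
    rw [one_mul, Nat.cast_ofNat]
    rcases h1.eq_or_lt with rfl | hlt
    · simp only [hX.self_eq_zero h0 h2, abs_zero, sub_self]
      positivity
    · have e3 := (abs_apply_le_norm (XX s t) (i, j)).trans (h₂ s t h0 hlt h2)
      rw [one_div_div] at e3
      refine e3.trans (Real.rpow_le_rpow e2 ?_ (by positivity))
      linarith
  · by_cases hT : 0 ≤ T
    -- Time is one summand of the control, so `t - s` is at most its first power, and `2 / p ≤ 1`
    -- allows lowering the exponent.
    · obtain ⟨C, hC, h⟩ := hω.rpow_le hT (x := (2 : ℕ) / p) (y := 1) (by positivity)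
        (by rw [div_le_one (by linarith)]; push_cast; exact hp.le)
      refine ⟨C, hC, fun s t h0 h1 h2 => ?_⟩
      have e1 := hω₁.nonneg s t h0 h1 h2
      have e2 := hω₂.nonneg s t h0 h1 h2
      refine le_trans ?_ (h s t h0 h1 h2)
      rw [Real.rpow_one, abs_of_nonneg (by linarith)]
      linarith
    · exact ⟨0, le_rfl, fun s t h0 h1 h2 => absurd (h0.trans (h1.trans h2)) hT⟩

theorem IsRoughPath.homBound_extPath (hX : IsRoughPath p T X XX) (hp : 2 < p) {ω : ℝ → ℝ → ℝ}
    (hω : IsControl T ω) (h1 : ∀ i, HomBound p T ω 1 (fun s t => X t i - X s i))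
    (h2 : ∀ i j, HomBound p T ω 2 (fun s t => XX s t (i, j)))
    (h3 : HomBound p T ω 2 (fun s t => t - s)) (a : ExtIndex d) :
    HomBound p T ω (extWeight a) (fun s t => extPath X XX t a - extPath X XX s a) := by
  cases a with
  | time => exact h3
  | path i => exact h1 i
  | brack ij =>
    refine (((h1 ij.1.1).mul hω (by linarith) (h1 ij.1.2)).sub
      ((h2 ij.1.1 ij.1.2).add (h2 ij.1.2 ij.1.1))).congr fun s t h0 h1 h2 => ?_
    exact hX.bracket_sub h0 h1 h2 _ _

theorem IsRoughPath.continuousOn_extPath (hX : IsRoughPath p T X XX) (a : ExtIndex d) :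
    ContinuousOn (fun t => extPath X XX t a) (Set.Icc 0 T) := by
  have hXi : ∀ i, ContinuousOn (fun t => X t i) (Set.Icc 0 T) := fun i =>
    (EuclideanSpace.proj (𝕜 := ℝ) i).continuous.comp_continuousOn hX.continuousOn_fst
  have hXXi : ∀ i j, ContinuousOn (fun t => XX 0 t (i, j)) (Set.Icc 0 T) := fun i j => by
    have h : ContinuousOn (fun t => XX 0 t) (Set.Icc 0 T) :=
      hX.continuousOn_snd.comp (f := fun t : ℝ => ((0 : ℝ), t)) (by fun_prop)
        fun t ht => ⟨le_rfl, ht.1, ht.2⟩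
    exact (EuclideanSpace.proj (𝕜 := ℝ) (i, j)).continuous.comp_continuousOn h
  cases a with
  | time => exact continuousOn_id
  | path i => exact hXi i
  | brack ij =>
    have h1 := (hXi ij.1.1).sub (continuousOn_const (c := X 0 ij.1.1))
    have h2 := (hXi ij.1.2).sub (continuousOn_const (c := X 0 ij.1.2))
    exact (h1.mul h2).sub ((hXXi ij.1.1 ij.1.2).add (hXXi ij.1.2 ij.1.1))

theorem IsRoughPath.isWeightedFunctional_extBase (hX : IsRoughPath p T X XX) (hp : 2 < p)
    {ω : ℝ → ℝ → ℝ} (hω : IsControl T ω)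
    (h1 : ∀ i, HomBound p T ω 1 (fun s t => X t i - X s i))
    (h2 : ∀ i j, HomBound p T ω 2 (fun s t => XX s t (i, j)))
    (h3 : HomBound p T ω 2 (fun s t => t - s)) :
    IsWeightedFunctional extWeight p T ω 2 (extBase X XX) where
  nil s t _ _ _ := rfl
  chen w hw s u t h0 h1 h2 h3 := by
    rcases cases_of_weight_le_two hw with rfl | ⟨a, rfl⟩ | ⟨i, j, rfl⟩
    · simp [TSeries.tensor, extBase]
    · simp [TSeries.tensor, extBase, Finset.sum_range_succ]
    · simp only [TSeries.tensor, extBase, Finset.sum_range_succ, List.length_cons,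
        List.length_nil, hX.chen s u t h0 h1 h2 h3 i j, extPath]
      simp
      ring
  bound w hw := by
    rcases cases_of_weight_le_two hw with rfl | ⟨a, rfl⟩ | ⟨i, j, rfl⟩
    · exact ⟨1, zero_le_one, fun s t _ _ _ => by simp [extBase, weight]⟩
    · simpa [weight, extBase] using hX.homBound_extPath hp hω h1 h2 h3 a
    · exact h2 i j
  cont w hw := by
    rcases cases_of_weight_le_two hw with rfl | ⟨a, rfl⟩ | ⟨i, j, rfl⟩
    · exact continuousOn_const
    · refine ContinuousOn.sub ((hX.continuousOn_extPath a).comp (by fun_prop) ?_)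
        ((hX.continuousOn_extPath a).comp (by fun_prop) ?_)
      · exact fun x hx => ⟨hx.1.trans hx.2.1, hx.2.2⟩
      · exact fun x hx => ⟨hx.1, hx.2.1.trans hx.2.2⟩
    · exact (EuclideanSpace.proj (𝕜 := ℝ) (i, j)).continuous.comp_continuousOn hX.continuousOn_snd

/-- The signature of the extended path, with the sharp homogeneity of all components. -/
structure IsExtSignature (p T : ℝ) (X : ℝ → EuclideanSpace ℝ (Fin d))
    (XX : ℝ → ℝ → EuclideanSpace ℝ (Fin d × Fin d)) (ω : ℝ → ℝ → ℝ)
    (S : ℝ → ℝ → TSeries (ExtIndex d)) : Prop where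
  control : IsControl T ω
  functional : ∀ n, IsWeightedFunctional extWeight p T ω n S
  base : ∀ s t w, weight extWeight w ≤ 2 → S s t w = extBase X XX s t w

/-- The base level 2 suffices because `p < 3` puts weight 3 above the sewing threshold. -/
theorem IsRoughPath.exists_extSignature (hX : IsRoughPath p T X XX) (hp : 2 < p) (hp' : p < 3)
    (hT : 0 ≤ T) : ∃ ω S, IsExtSignature p T X XX ω S := by
  obtain ⟨ω, hω, h1, h2, h3⟩ := hX.exists_control hp
  obtain ⟨S, hS, hS'⟩ := (hX.isWeightedFunctional_extBase hp hω h1 h2 h3).exists_extension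
    one_le_extWeight (by linarith) hT hω (by push_cast; linarith)
  exact ⟨ω, S, hω, hS, hS'⟩

end

/-! ### The constructed signature as Lyons' extension, and its uniqueness -/

namespace IsExtSignature

variable {p T : ℝ} {X : ℝ → EuclideanSpace ℝ (Fin d)}
  {XX : ℝ → ℝ → EuclideanSpace ℝ (Fin d × Fin d)} {ω : ℝ → ℝ → ℝ}
  {S : ℝ → ℝ → TSeries (ExtIndex d)}

theorem nil (hS : IsExtSignature p T X XX ω S) (s t : ℝ) : S s t [] = 1 :=
  hS.base s t [] (by simp [weight])

theorem singleton (hS : IsExtSignature p T X XX ω S) (s t : ℝ) (a : ExtIndex d) :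
    S s t [a] = extPath X XX t a - extPath X XX s a :=
  hS.base s t [a] (by cases a <;> simp [weight, extWeight])

theorem path_path (hS : IsExtSignature p T X XX ω S) (s t : ℝ) (i j : Fin d) :
    S s t [.path i, .path j] = XX s t (i, j) :=
  hS.base s t _ (by simp [weight, extWeight])

theorem chen (hS : IsExtSignature p T X XX ω S) {s u t : ℝ} (h0 : 0 ≤ s) (h1 : s ≤ u) (h2 : u ≤ t)
    (h3 : t ≤ T) : (S s u).tensor (S u t) = S s t :=
  funext fun w => (hS.functional _).chen w le_rfl s u t h0 h1 h2 h3

theorem bound (hS : IsExtSignature p T X XX ω S) (w : List (ExtIndex d)) :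
    HomBound p T ω (weight extWeight w) (fun s t => S s t w) :=
  (hS.functional _).bound w le_rfl

theorem cont (hS : IsExtSignature p T X XX ω S) (w : List (ExtIndex d)) :
    ContinuousOn (fun x : ℝ × ℝ => S x.1 x.2 w) (simplex T) :=
  (hS.functional _).cont w le_rfl

/-- Forgets the sharp weights: every letter weighs at least 1, and homogeneity by length is what
finite `p/m`-variation of level `m` asks for. -/
theorem bound_length (hS : IsExtSignature p T X XX ω S) (hp : 0 < p) (hT : 0 ≤ T)
    (w : List (ExtIndex d)) : HomBound p T ω w.length (fun s t => S s t w) :=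
  (hS.bound w).mono hS.control hT hp (length_le_weight one_le_extWeight w)

theorem chen_pair (hS : IsExtSignature p T X XX ω S) {s u t : ℝ} (h0 : 0 ≤ s) (h1 : s ≤ u)
    (h2 : u ≤ t) (h3 : t ≤ T) (a b : ExtIndex d) :
    S s t [a, b] = S s u [a, b] + S u t [a, b]
      + (extPath X XX u a - extPath X XX s a) * (extPath X XX t b - extPath X XX u b) := by
  rw [← hS.chen h0 h1 h2 h3, TSeries.tensor_eq_mid _ _ (by simp), hS.nil, hS.nil]
  simp [TSeries.mid, hS.singleton]
  ring

/-- By Chen's relation a left-point Riemann sum equals `S s t [a, b]` minus the sum of the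
coefficients over the partition intervals. These have weight at least 3 > `p`, so their sum vanishes
with the mesh. -/
theorem hasYoungIntegral (hS : IsExtSignature p T X XX ω S) (hp : 0 < p) (hp' : p < 3) {s t : ℝ}
    (h0 : 0 ≤ s) (hst : s ≤ t) (h1 : t ≤ T) {a b : ExtIndex d}
    (hab : ¬ ((∃ i, a = .path i) ∧ ∃ j, b = .path j)) :
    HasYoungIntegral (fun r => extPath X XX r a - extPath X XX s a)
      (fun r => extPath X XX r b) s t (S s t [a, b]) := by
  have hw : 3 ≤ weight extWeight [a, b] := by
    by_contra hcon
    rcases cases_of_weight_le_two (w := [a, b]) (by omega) with h | ⟨c, h⟩ | ⟨i, j, h⟩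
    · simp at h
    · simp at h
    · simp only [List.cons.injEq, and_true] at h
      exact hab ⟨⟨i, h.1⟩, ⟨j, h.2⟩⟩
  have hself : ∀ s, 0 ≤ s → s ≤ T → S s s [a, b] = 0 := fun s h0 h1 =>
    (hS.bound [a, b]).self_eq_zero hS.control hp (by omega) h0 h1
  obtain ⟨C, hC, hb⟩ := hS.bound [a, b]
  have hθ : 1 < (weight extWeight [a, b] : ℝ) / p := by
    rw [one_lt_div hp]
    have : (3 : ℝ) ≤ (weight extWeight [a, b] : ℝ) := by exact_mod_cast hw
    linarith
  have hlim := tendsto_sum_meshZero hS.control (A := fun s t => S s t [a, b])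
    (SmallDiag.of_continuousOn (hS.cont [a, b]) hself) hθ hC hb h0 hst h1
  have hlim' := hlim.const_sub (S s t [a, b])
  rw [sub_zero] at hlim'
  refine hlim'.congr fun P => ?_
  have htel := sum_partition_additive (T := T) (D := fun u v => S s v [a, b] - S s u [a, b])
    (fun _ _ _ _ _ _ _ => by ring) h0 h1 P
  rw [hself s h0 (hst.trans h1), sub_zero] at htel
  rw [← htel, ← Finset.sum_sub_distrib]
  refine Finset.sum_congr rfl fun i _ => ?_
  rw [hS.chen_pair h0 (P.mem_Icc i.castSucc).1
    (P.strictMono.monotone i.castSucc_lt_succ.le) ((P.mem_Icc i.succ).2.trans h1)]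
  ring

/-- The second level of the signature. -/
def secondLevel (S : ℝ → ℝ → TSeries (ExtIndex d)) (s t : ℝ) :
    EuclideanSpace ℝ (ExtIndex d × ExtIndex d) :=
  WithLp.toLp 2 fun ab => S s t [ab.1, ab.2]

theorem isExtLift (hS : IsExtSignature p T X XX ω S) (hp : 0 < p) (hp' : p < 3) :
    IsExtLift T X XX (secondLevel S) where
  path_path s t _ _ _ i j := hS.path_path s t i j
  young _ _ h0 h1 h2 _ _ hab := hS.hasYoungIntegral hp hp' h0 h1 h2 hab

theorem isRoughPath (hS : IsExtSignature p T X XX ω S) (hX : IsRoughPath p T X XX) (hp : 0 < p)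
    (hT : 0 ≤ T) : IsRoughPath p T (extPath X XX) (secondLevel S) where
  continuousOn_fst := (PiLp.continuous_toLp 2 _).comp_continuousOn
    (continuousOn_pi.2 fun a => hX.continuousOn_extPath a)
  variation_fst := by
    have := variation_lt_top_of_homBound hp hS.control (n := 1) le_rfl
      (A := fun s t => extPath X XX t - extPath X XX s) fun a =>
      (hS.bound_length hp hT [a]).congr fun s t _ _ _ => (hS.singleton s t a).symm
    simpa using this
  continuousOn_snd := (PiLp.continuous_toLp 2 _).comp_continuousOn
    (continuousOn_pi.2 fun ab => hS.cont [ab.1, ab.2])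
  variation_snd := by
    have := variation_lt_top_of_homBound hp hS.control (n := 2) one_le_two
      (A := secondLevel S) fun ab => hS.bound_length hp hT [ab.1, ab.2]
    simpa using this
  chen _ _ _ h0 h1 h2 h3 a b := hS.chen_pair h0 h1 h2 h3 a b

theorem isLyonsExtension (hS : IsExtSignature p T X XX ω S) (hp : 0 < p) (hT : 0 ≤ T) :
    IsLyonsExtension p T (extPath X XX) (secondLevel S) S where
  level_zero s t _ _ _ := hS.nil s t
  level_one s t _ _ _ a := hS.singleton s t a
  level_two _ _ _ _ _ _ _ := rfl
  chen _ _ _ h0 h1 h2 h3 := hS.chen h0 h1 h2 h3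
  continuousOn w := hS.cont w
  variation_lt_top m hm := by
    refine variation_lt_top_of_homBound hp hS.control hm fun w => ?_
    have := hS.bound_length hp hT (List.ofFn w)
    rw [List.length_ofFn] at this
    exact this

/-- Uniqueness of the Lyons extension of the extended path. -/
theorem eq_of_isLyonsExtension (hS : IsExtSignature p T X XX ω S) (hp : 0 < p) (hp' : p < 3)
    (hT : 0 ≤ T) {XXh : ℝ → ℝ → EuclideanSpace ℝ (ExtIndex d × ExtIndex d)}
    {S' : ℝ → ℝ → TSeries (ExtIndex d)} (hXXh : IsExtLift T X XX XXh)
    (hS' : IsLyonsExtension p T (extPath X XX) XXh S') :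
    ∀ (n : ℕ) (w : List (ExtIndex d)), w.length = n → ∀ s t, 0 ≤ s → s ≤ t → t ≤ T →
      S' s t w = S s t w := by
  intro n
  induction n using Nat.strong_induction_on with
  | _ n ih =>
    intro w hw s t h0 h1 h2
    match w, hw with
    | [], _ => rw [hS'.level_zero s t h0 h1 h2, hS.nil]
    | [a], _ => rw [hS'.level_one s t h0 h1 h2, hS.singleton]
    | [a, b], _ =>
      rw [hS'.level_two s t h0 h1 h2]
      by_cases hab : (∃ i, a = .path i) ∧ ∃ j, b = .path j
      · obtain ⟨⟨i, rfl⟩, ⟨j, rfl⟩⟩ := hab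
        rw [hXXh.path_path s t h0 h1 h2, hS.path_path]
      · have := meshZero_neBot h1
        exact tendsto_nhds_unique (hXXh.young s t h0 h1 h2 a b hab)
          (hS.hasYoungIntegral hp hp' h0 h1 h2 hab)
    | a :: b :: c :: v, hw =>
      set w := a :: b :: c :: v with hwdef
      have hwne : w ≠ [] := by simp [hwdef]
      have hn3 : 3 ≤ n := by rw [← hw]; simp [hwdef]
      -- The competing extension supplies a control only level by level, so one is taken for the
      -- current length `n` and added to `ω`.
      obtain ⟨ω', hω', hb'⟩ := exists_control_of_variation (by positivity)
        (hS'.variation_lt_top n (by omega))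
      obtain ⟨C, hC, hb⟩ := hS.bound_length hp hT w
      rw [hw] at hb
      have hθ : 1 < (n : ℝ) / p := by
        rw [one_lt_div hp]
        have : (3 : ℝ) ≤ n := by exact_mod_cast hn3
        linarith
      have hadd : ∀ s u t, 0 ≤ s → s ≤ u → u ≤ t → t ≤ T →
          S' s t w - S s t w = (S' s u w - S s u w) + (S' u t w - S u t w) := by
        intro s u t h0 h1 h2 h3
        have e1 := congrFun (hS'.chen s u t h0 h1 h2 h3) w
        have e2 := congrFun (hS.chen h0 h1 h2 h3) w
        rw [TSeries.tensor_eq_mid _ _ hwne, hS'.level_zero s u h0 h1 (h2.trans h3),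
          hS'.level_zero u t (h0.trans h1) h2 h3] at e1
        rw [TSeries.tensor_eq_mid _ _ hwne, hS.nil, hS.nil] at e2
        -- Proper splittings agree by the induction hypothesis, so the non-additive parts of Chen's
        -- relation cancel in the difference.
        have e3 : (S' s u).mid (S' u t) w = (S s u).mid (S u t) w := by
          refine Finset.sum_congr rfl fun k hk => ?_
          rw [Finset.mem_Ico] at hk
          rw [ih (w.take k).length (by rw [List.length_take]; omega) _ rfl s u h0 h1
              (h2.trans h3),
            ih (w.drop k).length (by rw [List.length_drop]; omega) _ rfl u t (h0.trans h1) h2 h3]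
        linarith
      refine sub_eq_zero.1 (additive_eq_zero (hω'.add hS.control)
        (D := fun s t => S' s t w - S s t w) hadd ((hS'.continuousOn w).sub (hS.cont w)) hθ
        (C := 1 + C) (by positivity) (fun s t h0 h1 h2 => ?_) h0 h1 h2)
      have e1 := hω'.nonneg s t h0 h1.le h2
      have e2 := hS.control.nonneg s t h0 h1.le h2
      have e3 : |S' s t w| ≤ 1 * (ω' s t + ω s t) ^ ((n : ℝ) / p) := by
        subst hw
        have := (abs_apply_le_norm ((S' s t).level w.length) w.get).trans (hb' s t h0 h1 h2)
        rw [one_div_div] at this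
        simp only [TSeries.level, List.ofFn_get] at this
        rw [one_mul]
        exact this.trans (Real.rpow_le_rpow e1 (by linarith) (by positivity))
      have e4 : |S s t w| ≤ C * (ω' s t + ω s t) ^ ((n : ℝ) / p) :=
        (hb s t h0 h1.le h2).trans (mul_le_mul_of_nonneg_left
          (Real.rpow_le_rpow e2 (by linarith) (by positivity)) hC)
      rw [add_mul]
      exact (abs_sub _ _).trans (add_le_add e3 e4)

end IsExtSignature

/-! ### The quasi-shuffle product and deconcatenation -/

section

variable {ι : Type*}

theorem pairing_e (I : List ι) (a : TSeries ι) : pairing (e I) a = a I := by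
  simp [pairing, e]

theorem pairing_zero (a : TSeries ι) : pairing 0 a = 0 := by
  simp [pairing]

theorem pairing_add (x y : TAlg ι) (a : TSeries ι) :
    pairing (x + y) a = pairing x a + pairing y a := by
  simp only [pairing, MonoidAlgebra.coeff_add]
  exact Finsupp.sum_add_index' (by simp) (by intros; ring)

/-- The adjoint of right multiplication by a letter. -/
def TSeries.shift (i : ι) (a : TSeries ι) : TSeries ι := fun w => a (w ++ [i])

theorem pairing_mul_e (x : TAlg ι) (i : ι) (a : TSeries ι) :
    pairing (x * e [i]) a = pairing x (a.shift i) := by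
  induction x using MonoidAlgebra.induction_linear with
  | zero => simp [pairing_zero]
  | add x y hx hy => rw [add_mul, pairing_add, pairing_add, hx, hy]
  | single w c =>
    rw [e, MonoidAlgebra.single_mul_single]
    simp [pairing, TSeries.shift]

theorem pairing_add_right (x : TAlg ι) (a b : TSeries ι) :
    pairing x (fun w => a w + b w) = pairing x a + pairing x b := by
  simp only [pairing, mul_add, Finsupp.sum_add]

theorem pairing_smul_right (x : TAlg ι) (c : ℝ) (a : TSeries ι) :
    pairing x (fun w => c * a w) = c * pairing x a := by
  simp only [pairing, Finsupp.mul_sum]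
  exact Finsupp.sum_congr fun w _ => by ring

theorem pairing_zero_right (x : TAlg ι) : pairing x (fun _ => 0) = 0 := by
  simp [pairing]

/-- The final letter belongs to the right factor unless the right piece of the splitting is empty;
the empty case is the separate first term. -/
theorem TSeries.shift_tensor (i : ι) (a b : TSeries ι) :
    (a.tensor b).shift i = fun w => b [] * a.shift i w + a.tensor (b.shift i) w := by
  funext w
  simp only [TSeries.shift, TSeries.tensor, List.length_append, List.length_cons, List.length_nil]
  rw [Finset.sum_range_succ, add_comm]
  congr 1
  · rw [List.take_of_length_le (by simp), List.drop_of_length_le (by simp), mul_comm]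
  · refine Finset.sum_congr rfl fun k hk => ?_
    have hk' : k ≤ w.length := by simp at hk; omega
    rw [List.take_append_of_le_length hk', List.drop_append_of_le_length hk']

end

/-- The adjoint of right multiplication by the bracket letter `ε_{ij}`. -/
def epsShift : ExtIndex d → ExtIndex d → TSeries (ExtIndex d) → TSeries (ExtIndex d)
  | .path i, .path j, a => a.shift (.brack ⟨(min i j, max i j), min_le_max⟩)
  | _, _, _ => fun _ => 0

theorem pairing_mul_eps (x : TAlg (ExtIndex d)) (i j : ExtIndex d) (a : TSeries (ExtIndex d)) :
    pairing (x * eps i j) a = pairing x (epsShift i j a) := by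
  cases i <;> cases j <;>
    simp [eps, epsShift, pairing_mul_e, pairing_zero, pairing_zero_right]

theorem epsShift_tensor (i j : ExtIndex d) (a b : TSeries (ExtIndex d)) :
    epsShift i j (a.tensor b) = fun w => b [] * epsShift i j a w + a.tensor (epsShift i j b) w := by
  cases i <;> cases j <;> simp [epsShift, TSeries.shift_tensor, TSeries.tensor]

/-- The pairing with the quasi-shuffle of two reversed words. -/
def qs (I J : List (ExtIndex d)) (a : TSeries (ExtIndex d)) : ℝ := pairing (quasiShuffleRev I J) a

theorem qs_nil_left (J : List (ExtIndex d)) (a : TSeries (ExtIndex d)) :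
    qs [] J a = a J.reverse := by
  rw [qs, quasiShuffleRev, pairing_e]

theorem qs_nil_right (I : List (ExtIndex d)) (a : TSeries (ExtIndex d)) :
    qs I [] a = a I.reverse := by
  cases I with
  | nil => exact qs_nil_left [] a
  | cons i I => rw [qs, quasiShuffleRev, pairing_e]

theorem qs_cons_cons (i j : ExtIndex d) (I J : List (ExtIndex d)) (a : TSeries (ExtIndex d)) :
    qs (i :: I) (j :: J) a
      = qs I (j :: J) (a.shift i) + qs (i :: I) J (a.shift j) + qs I J (epsShift i j a) := by
  rw [qs, quasiShuffleRev, pairing_add, pairing_add, pairing_mul_e, pairing_mul_e,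
    pairing_mul_eps]
  rfl

/-- The sum over all splittings of a pair of reversed words. -/
def splitSum (I J : List (ExtIndex d)) (a b : TSeries (ExtIndex d)) : ℝ :=
  -- The words are reversed, so `take` selects the last letters, which pair with the right factor
  -- `b`.
  ∑ k ∈ Finset.range (I.length + 1), ∑ l ∈ Finset.range (J.length + 1),
    qs (I.drop k) (J.drop l) a * qs (I.take k) (J.take l) b

theorem qs_lin (I J : List (ExtIndex d)) (c : ℝ) (a b : TSeries (ExtIndex d)) :
    qs I J (fun w => c * a w + b w) = c * qs I J a + qs I J b := by
  rw [qs, pairing_add_right _ (fun w => c * a w), pairing_smul_right]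
  rfl

theorem splitSum_nil_left (J : List (ExtIndex d)) (a b : TSeries (ExtIndex d)) :
    a.tensor b J.reverse = splitSum [] J a b := by
  simp only [splitSum, List.length_nil, zero_add, Finset.range_one, Finset.sum_singleton,
    List.drop_nil, List.take_nil, qs_nil_left, TSeries.tensor, List.length_reverse]
  rw [← Finset.sum_range_reflect]
  refine Finset.sum_congr rfl fun k hk => ?_
  have hk' : k ≤ J.length := by simp at hk; omega
  rw [List.take_reverse, List.drop_reverse]
  congr 4 <;> omega

theorem splitSum_nil_right (I : List (ExtIndex d)) (a b : TSeries (ExtIndex d)) :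
    a.tensor b I.reverse = splitSum I [] a b := by
  rw [splitSum_nil_left]
  simp [splitSum, qs_nil_left, qs_nil_right]

/-- The term `k = l = 0` gives the part with `b []`. In every other term the quasi-shuffle
recursion, or its trivial case, acts on the pieces paired with `b`; regrouping by the last letter
removed gives the other three sums. -/
theorem splitSum_cons_cons (i j : ExtIndex d) (I J : List (ExtIndex d))
    (a b : TSeries (ExtIndex d)) :
    splitSum (i :: I) (j :: J) a b = b [] * qs (i :: I) (j :: J) a
      + splitSum I (j :: J) a (b.shift i) + splitSum (i :: I) J a (b.shift j)
      + splitSum I J a (epsShift i j b) := by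
  simp only [splitSum, List.length_cons]
  rw [Finset.sum_range_succ' _ (I.length + 1), Finset.sum_range_succ' _ (J.length + 1),
    Finset.sum_range_succ' (fun k => ∑ l ∈ Finset.range (J.length + 1),
      qs ((i :: I).drop k) (J.drop l) a * qs ((i :: I).take k) (J.take l) (b.shift j))
      (I.length + 1)]
  simp only [Finset.sum_range_succ' _ (J.length + 1), List.drop_succ_cons, List.take_succ_cons,
    List.drop_zero, List.take_zero, qs_cons_cons i j _ _ b, qs_nil_left, qs_nil_right,
    mul_add, Finset.sum_add_distrib, List.reverse_cons, TSeries.shift, List.reverse_nil]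
  ring

/-- Deconcatenation is multiplicative for the quasi-shuffle product. -/
theorem qs_tensor : ∀ (I J : List (ExtIndex d)) (a b : TSeries (ExtIndex d)),
    qs I J (a.tensor b) = splitSum I J a b
  | [], J, a, b => by rw [qs_nil_left, splitSum_nil_left]
  | i :: I, [], a, b => by rw [qs_nil_right, splitSum_nil_right]
  | i :: I, j :: J, a, b => by
    -- The three terms of the recursion each leave a multiple of `b []`; together these rebuild `b
    -- [] * qs (i :: I) (j :: J) a`.
    rw [qs_cons_cons, TSeries.shift_tensor, TSeries.shift_tensor, epsShift_tensor, qs_lin, qs_lin,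
      qs_lin, qs_tensor I (j :: J), qs_tensor (i :: I) J, qs_tensor I J, splitSum_cons_cons,
      qs_cons_cons i j I J a]
    ring
  termination_by I J => I.length + J.length

/-- Products of coefficients under the tensor product. -/
theorem tensor_mul_tensor (I J : List (ExtIndex d)) (a b : TSeries (ExtIndex d)) :
    a.tensor b I.reverse * a.tensor b J.reverse
      = ∑ k ∈ Finset.range (I.length + 1), ∑ l ∈ Finset.range (J.length + 1),
        (a (I.drop k).reverse * a (J.drop l).reverse)
          * (b (I.take k).reverse * b (J.take l).reverse) := by
  rw [splitSum_nil_right I, splitSum_nil_left J]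
  simp only [splitSum, List.length_nil, zero_add, Finset.range_one, Finset.sum_singleton,
    List.drop_nil, List.take_nil, qs_nil_left, qs_nil_right]
  rw [Finset.sum_mul_sum]
  exact Finset.sum_congr rfl fun k _ => Finset.sum_congr rfl fun l _ => by ring

/-! ### Bounds and continuity -/

theorem homBound_epsShift {p T : ℝ} {ω : ℝ → ℝ → ℝ} {m : ℕ} {a : ℝ → ℝ → TSeries (ExtIndex d)}
    (ha : ∀ w, HomBound p T ω (weight extWeight w + m) (fun s t => a s t w)) (i j : ExtIndex d)
    (w : List (ExtIndex d)) :
    HomBound p T ω (weight extWeight w + (extWeight i + extWeight j + m))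
      (fun s t => epsShift i j (a s t) w) := by
  cases i with
  | path i =>
    cases j with
    | path j =>
      have := ha (w ++ [.brack ⟨(min i j, max i j), min_le_max⟩])
      rw [weight_append, weight_cons, weight_nil] at this
      simp only [extWeight] at this ⊢
      rwa [show weight extWeight w + (1 + 1 + m) = weight extWeight w + (2 + 0) + m by ring]
    | _ => exact HomBound.zero _ _ _ _
  | _ => exact HomBound.zero _ _ _ _

theorem homBound_shift {p T : ℝ} {ω : ℝ → ℝ → ℝ} {m : ℕ} {a : ℝ → ℝ → TSeries (ExtIndex d)}
    (ha : ∀ w, HomBound p T ω (weight extWeight w + m) (fun s t => a s t w)) (i : ExtIndex d)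
    (w : List (ExtIndex d)) :
    HomBound p T ω (weight extWeight w + (extWeight i + m))
      (fun s t => (a s t).shift i w) := by
  have := ha (w ++ [i])
  rw [weight_append, weight_cons, weight_nil] at this
  rwa [show weight extWeight w + (extWeight i + m)
    = weight extWeight w + (extWeight i + 0) + m by ring]

theorem weight_reverse {ι : Type*} (wt : ι → ℕ) (w : List ι) :
    weight wt w.reverse = weight wt w := by
  simp [weight, List.sum_reverse]

/-- All words in a quasi-shuffle have the same total weight. The parameter `m` records the weight of
the letters already moved from the words into the shifted functional `a`. -/
theorem homBound_qs {p T : ℝ} {ω : ℝ → ℝ → ℝ} : ∀ (I J : List (ExtIndex d)) (m : ℕ)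
    (a : ℝ → ℝ → TSeries (ExtIndex d)),
    (∀ w, HomBound p T ω (weight extWeight w + m) (fun s t => a s t w)) →
    HomBound p T ω (weight extWeight I + weight extWeight J + m) (fun s t => qs I J (a s t))
  | [], J, m, a, ha => by
    simpa only [qs_nil_left, weight_nil, zero_add, weight_reverse] using ha J.reverse
  | i :: I, [], m, a, ha => by
    simpa only [qs_nil_right, weight_nil, add_zero, weight_reverse] using ha (i :: I).reverse
  | i :: I, j :: J, m, a, ha => by
    have h1 := homBound_qs I (j :: J) _ _ (homBound_shift ha i)
    have h2 := homBound_qs (i :: I) J _ _ (homBound_shift ha j)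
    have h3 := homBound_qs I J _ _ (homBound_epsShift ha i j)
    simp only [qs_cons_cons, weight_cons] at h1 h2 h3 ⊢
    refine HomBound.add (HomBound.add ?_ ?_) ?_
    · convert h1 using 1; ring
    · convert h2 using 1; ring
    · convert h3 using 1; ring
  termination_by I J => I.length + J.length

theorem continuousOn_epsShift {T : ℝ} {a : ℝ → ℝ → TSeries (ExtIndex d)}
    (ha : ∀ w, ContinuousOn (fun x : ℝ × ℝ => a x.1 x.2 w) (simplex T)) (i j : ExtIndex d)
    (w : List (ExtIndex d)) :
    ContinuousOn (fun x : ℝ × ℝ => epsShift i j (a x.1 x.2) w) (simplex T) := by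
  cases i with
  | path i =>
    cases j with
    | path j => exact ha _
    | _ => exact continuousOn_const
  | _ => exact continuousOn_const

theorem continuousOn_qs {T : ℝ} : ∀ (I J : List (ExtIndex d)) (a : ℝ → ℝ → TSeries (ExtIndex d)),
    (∀ w, ContinuousOn (fun x : ℝ × ℝ => a x.1 x.2 w) (simplex T)) →
    ContinuousOn (fun x : ℝ × ℝ => qs I J (a x.1 x.2)) (simplex T)
  | [], J, a, ha => by simpa only [qs_nil_left] using ha J.reverse
  | i :: I, [], a, ha => by simpa only [qs_nil_right] using ha (i :: I).reverse
  | i :: I, j :: J, a, ha => by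
    have h1 := continuousOn_qs I (j :: J) (fun s t => (a s t).shift i) fun w => ha _
    have h2 := continuousOn_qs (i :: I) J (fun s t => (a s t).shift j) fun w => ha _
    have h3 := continuousOn_qs I J (fun s t => epsShift i j (a s t)) (continuousOn_epsShift ha i j)
    simp only [qs_cons_cons]
    exact (h1.add h2).add h3
  termination_by I J => I.length + J.length

/-! ### The quasi-shuffle identity -/

/-- The increment form of the bracket definition, and the only place where a quasi-shuffle relation
enters as data. The `min` and `max` in the bracket letter are harmless since the right side of
`bracket_sub` is symmetric. -/
theorem IsExtSignature.path_mul_path {p T : ℝ} {X : ℝ → EuclideanSpace ℝ (Fin d)}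
    {XX : ℝ → ℝ → EuclideanSpace ℝ (Fin d × Fin d)} {ω : ℝ → ℝ → ℝ}
    {S : ℝ → ℝ → TSeries (ExtIndex d)} (hS : IsExtSignature p T X XX ω S)
    (hX : IsRoughPath p T X XX) {s t : ℝ} (h0 : 0 ≤ s) (h1 : s ≤ t) (h2 : t ≤ T) (i j : Fin d) :
    S s t [.path i] * S s t [.path j] = qs [.path i] [.path j] (S s t) := by
  have hb := hX.bracket_sub h0 h1 h2 (min i j) (max i j)
  rw [qs_cons_cons, qs_nil_left, qs_nil_right, qs_nil_left]
  simp only [TSeries.shift, epsShift, List.reverse_cons, List.reverse_nil, List.nil_append,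
    List.cons_append, hS.path_path, hS.singleton, extPath]
  rw [hb]
  rcases le_total i j with h | h
  · rw [min_eq_left h, max_eq_right h]; ring
  · rw [min_eq_right h, max_eq_left h]; ring

/-- The quasi-shuffle identity for the signature of the extended path, on reversed words. -/
theorem IsExtSignature.mul_eq_qs {p T : ℝ} (hp : 0 < p) (hp' : p < 3)
    {X : ℝ → EuclideanSpace ℝ (Fin d)} {XX : ℝ → ℝ → EuclideanSpace ℝ (Fin d × Fin d)}
    {ω : ℝ → ℝ → ℝ} {S : ℝ → ℝ → TSeries (ExtIndex d)} (hS : IsExtSignature p T X XX ω S)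
    (hX : IsRoughPath p T X XX) : ∀ (n : ℕ) (I J : List (ExtIndex d)), I.length + J.length = n →
      ∀ s t, 0 ≤ s → s ≤ t → t ≤ T → S s t I.reverse * S s t J.reverse = qs I J (S s t) := by
  intro n
  induction n using Nat.strong_induction_on with
  | _ n ih =>
  intro I J hn s t h0 h1 h2
  rcases eq_or_ne I [] with hI | hI
  · rw [hI, qs_nil_left, List.reverse_nil, hS.nil, one_mul]
  rcases eq_or_ne J [] with hJ | hJ
  · rw [hJ, qs_nil_right, List.reverse_nil, hS.nil, mul_one]
  have hIlen : 1 ≤ I.length := List.length_pos_iff.2 hI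
  have hJlen : 1 ≤ J.length := List.length_pos_iff.2 hJ
  -- For nonempty words total weight at most 2 forces two single letters of `X`. This case is below
  -- the threshold and must be checked by hand.
  by_cases hw : weight extWeight I + weight extWeight J ≤ 2
  · have hI1 := length_le_weight one_le_extWeight I
    have hJ1 := length_le_weight one_le_extWeight J
    obtain ⟨a, rfl⟩ := List.length_eq_one_iff.1 (show I.length = 1 by omega)
    obtain ⟨b, rfl⟩ := List.length_eq_one_iff.1 (show J.length = 1 by omega)
    rw [weight_cons, weight_cons, weight_nil] at hw
    cases a with
    | path i =>
      cases b with
      | path j => exact hS.path_mul_path hX h0 h1 h2 i j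
      | _ => simp [extWeight] at hw
    | _ => exact absurd hw (by cases b <;> simp [extWeight])
  have hadd : ∀ s u t, 0 ≤ s → s ≤ u → u ≤ t → t ≤ T →
      S s t I.reverse * S s t J.reverse - qs I J (S s t)
        = (S s u I.reverse * S s u J.reverse - qs I J (S s u))
          + (S u t I.reverse * S u t J.reverse - qs I J (S u t)) := by
    intro s u t h0 h1 h2 h3
    rw [← hS.chen h0 h1 h2 h3, qs_tensor, tensor_mul_tensor, splitSum]
    simp only [← Finset.sum_sub_distrib]
    -- Both expressions expand over the same pairs of splittings. The two extreme pairs leave the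
    -- defects on `[s, u]` and `[u, t]`; in all others both pairs of pieces are shorter in total,
    -- and the induction hypothesis cancels the term.
    have hterm : ∀ k ∈ Finset.range (I.length + 1), ∀ l ∈ Finset.range (J.length + 1),
        S s u (I.drop k).reverse * S s u (J.drop l).reverse
            * (S u t (I.take k).reverse * S u t (J.take l).reverse)
          - qs (I.drop k) (J.drop l) (S s u) * qs (I.take k) (J.take l) (S u t)
        = (if k = 0 then if l = 0 then
            S s u I.reverse * S s u J.reverse - qs I J (S s u) else 0 else 0)
          + (if k = I.length then if l = J.length then
            S u t I.reverse * S u t J.reverse - qs I J (S u t) else 0 else 0) := by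
      intro k hk l hl
      rw [Finset.mem_range] at hk hl
      by_cases hkl : k = 0 ∧ l = 0
      · obtain ⟨rfl, rfl⟩ := hkl
        rw [if_neg (show ¬ 0 = I.length by omega)]
        simp [qs_nil_left, hS.nil]
      by_cases hkl' : k = I.length ∧ l = J.length
      · obtain ⟨rfl, rfl⟩ := hkl'
        rw [if_neg (show ¬ I.length = 0 by omega)]
        simp [qs_nil_left, hS.nil]
      · have e1 := ih ((I.drop k).length + (J.drop l).length)
          (by rw [List.length_drop, List.length_drop]; omega) _ _ rfl s u h0 h1 (h2.trans h3)
        have e2 := ih ((I.take k).length + (J.take l).length)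
          (by rw [List.length_take, List.length_take]; omega) _ _ rfl u t (h0.trans h1) h2 h3
        rw [e1, e2, sub_self, ← ite_and, ← ite_and, if_neg hkl, if_neg hkl', add_zero]
    rw [Finset.sum_congr rfl fun k hk => Finset.sum_congr rfl (hterm k hk)]
    simp only [Finset.sum_add_distrib]
    congr 1
    · simp
    · simp
  have hbound : HomBound p T ω (weight extWeight I + weight extWeight J)
      (fun s t => S s t I.reverse * S s t J.reverse - qs I J (S s t)) := by
    refine HomBound.sub ?_ ?_
    · have := (hS.bound I.reverse).mul hS.control hp (hS.bound J.reverse)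
      rwa [weight_reverse, weight_reverse] at this
    · exact homBound_qs I J 0 S hS.bound
  obtain ⟨C, hC, hb⟩ := hbound
  have hθ : 1 < ((weight extWeight I + weight extWeight J : ℕ) : ℝ) / p := by
    rw [one_lt_div hp]
    have : (3 : ℝ) ≤ ((weight extWeight I + weight extWeight J : ℕ) : ℝ) := by
      exact_mod_cast (by omega : 3 ≤ weight extWeight I + weight extWeight J)
    linarith
  exact sub_eq_zero.1 (additive_eq_zero hS.control
    (D := fun s t => S s t I.reverse * S s t J.reverse - qs I J (S s t)) hadd
    (((hS.cont I.reverse).mul (hS.cont J.reverse)).sub (continuousOn_qs I J S hS.cont)) hθ hC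
    (fun s t h0 h1 h2 => hb s t h0 h1.le h2) h0 h1 h2)

end RoughSig

end

-- The existence half ensures that the universal half is not vacuous. The identity is proved for the
-- constructed signature `R` and transferred to an arbitrary extension by uniqueness.
open RoughSig in
theorem mainTheorem2 (d : ℕ) (p T : ℝ) (hp : 2 < p) (hp' : p < 3) (hT : 0 < T)
    (X : ℝ → EuclideanSpace ℝ (Fin d)) (XX : ℝ → ℝ → EuclideanSpace ℝ (Fin d × Fin d))
    (hX : IsRoughPath p T X XX) :
    (∃ XXh S, IsExtLift T X XX XXh ∧ IsRoughPath p T (extPath X XX) XXh ∧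
      IsLyonsExtension p T (extPath X XX) XXh S) ∧
    ∀ XXh S, IsExtLift T X XX XXh → IsLyonsExtension p T (extPath X XX) XXh S →
      ∀ I J : List (ExtIndex d), ∀ t ∈ Set.Icc 0 T,
        pairing (e I) (S 0 t) * pairing (e J) (S 0 t) =
          pairing (quasiShuffle I J) (S 0 t) := by
  have hp0 : 0 < p := by linarith
  obtain ⟨ω, R, hR⟩ := hX.exists_extSignature hp hp' hT.le
  refine ⟨⟨_, R, hR.isExtLift hp0 hp', hR.isRoughPath hX hp0 hT.le,
    hR.isLyonsExtension hp0 hT.le⟩, fun XXh S hXXh hS I J t ht => ?_⟩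
  have hSR : S 0 t = R 0 t := funext fun w =>
    hR.eq_of_isLyonsExtension hp0 hp' hT.le hXXh hS _ w rfl 0 t le_rfl ht.1 ht.2
  have := hR.mul_eq_qs hp0 hp' hX _ I.reverse J.reverse rfl 0 t le_rfl ht.1 ht.2
  rw [List.reverse_reverse, List.reverse_reverse] at this
  rw [hSR, pairing_e, pairing_e, this]
  rfl
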